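/- Let $k$ be an algebraically closed field of characteristic $0$ (for instance $k=\mathbb C$) and let $\mathcal C$ be a modular category over $k$, with braiding $c$, twist $\theta$ and quantum trace $\operatorname{Tr}(\rho)=\mathrm{ev}\circ c_{X,X^*}\circ((\theta_X\circ\rho)\otimes\mathrm{id}_{X^*})\circ\mathrm{coev}\in\operatorname{End}(\mathbf 1)=k$ for $\rho\in\operatorname{End}(X)$. Let $N\ge 1$ and let $\mathcal C=\bigoplus_{i\in\mathbb Z/N}\mathcal C_i$ be a grading of $\mathcal C$ by $\mathbb Z/N$. Elements of $\mathbb Z/N$ that occur as exponents or in inequalities stand for their representatives in $\{0,\dots,N-1\}$. **Ribbon zestings.** The data of a ribbon zesting of $\mathcal C$ (with trivial $j$) are invertible objects $\lambda(i,j)\in\mathcal C_0$ with $\lambda(0,i)=\lambda(i,0)=\mathbf 1$, isomorphisms $\lambda_{i,j,l}:\lambda(i,j)\otimes\lambda(i+j,l)\to\lambda(j,l)\otimes\lambda(i,j+l)$ with $\lambda_{i,0,l}=\mathrm{id}$, isomorphisms $t(i,j):\lambda(i,j)\to\lambda(j,i)$ and scalars $f(i)\in k^\times$. Write $\chi_{L}(X)$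 for the scalar by which $c_{L,X}\circ c_{X,L}$ acts, when it is a scalar, and suppress associativity isomorphisms of $\mathcal C$. The data form a ribbon zesting if, for all $i,j,l,m\in\mathbb Z/N$: * $(\lambda_{j,l,m}\otimes\mathrm{id})(\mathrm{id}\otimes\lambda_{i,j+l,m})(\lambda_{i,j,l}\otimes\mathrm{id})=(\mathrm{id}\otimes\lambda_{i,j,l+m})(c_{\lambda(l,m),\lambda(i,j)}^{-1}\otimes\mathrm{id})(\mathrm{id}\otimes\lambda_{i+j,l,m})$; * $\lambda_{j,l,i}\,(\mathrm{id}\otimes t(i,j+l))\,\lambda_{i,j,l}=(\mathrm{id}\otimes t(i,l))\,\lambda_{j,i,l}\,(t(i,j)\otimes\mathrm{id})$; * $c_{\lambda(i,j),X}\circ c_{X,\lambda(i,j)}$ acts on $X\otimes\lambda(i,j)$, $X\in\mathcal C_l$, by a scalar $\chi_{\lambda(i,j)}(l)$ for which $\chi_{\lambda(i,j)}(l)\,\lambda_{l,i,j}^{-1}(\mathrm{id}\otimes t(i+j,l))\lambda_{i,j,l}^{-1}=(t(i,l)\otimes\mathrm{id})\,\lambda_{i,l,j}^{-1}\,(t(j,l)\otimes\mathrm{id})$;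 * $f(i+j)\,\chi_{\lambda(i,j)}(X\otimes Y)\,\theta_{\lambda(i,j)}=f(i)f(j)\,t(j,i)\,t(i,j)$ for $X\in\mathcal C_i$, $Y\in\mathcal C_j$; * $f(i)=f(-i)\,\chi_{\lambda(i,-i)}(X)\,\theta_{\lambda(i,-i)}$ for $X\in\mathcal C_i$. The zested ribbon category has the homogeneous objects and the morphisms of $\mathcal C$ (extended additively), the tensor product $X_i\otimes' Y_j=X_i\otimes Y_j\otimes\lambda(i,j)$, the associator that moves $\lambda(i,j)$ past the third object $Z$ by $c_{Z,\lambda(i,j)}^{-1}$ and then applies $\lambda_{i,j,l}$, the braiding $c_{X_i,Y_j}\otimes t(i,j)$ and the twist $f(i)\theta_{X_i}$. **Cyclic ribbon zestings.** Let $g\in\mathcal C_0$ generate a symmetric subcategory with the fusion rules of $\operatorname{Rep}(\mathbb Z/N)$, that is, $g^{\otimes n}\cong\mathbf 1$ if and only if $N\mid n$, and $c_{g,g}^2=\mathrm{id}$; let its categorical dimension be positive, i.e. $\dim g=1$. Let $\zeta\in k$ with $\zeta^{2N}=1$, let $a,b\in\mathbb Z/N$ and $s\in k^\times$, put $\epsilon(a)=1$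 if $\theta_{g^a}=-1$ and $\epsilon(a)=0$ otherwise, and suppose that $a\equiv\epsilon(a)+2b \pmod N$ and $s^N=\zeta^{-(\epsilon(a)+2b)}$. Consider the data $$\lambda_a(i,j)=\begin{cases}\mathbf 1& i+j<N\\ g^a& i+j\ge N\end{cases},\qquad \lambda_b(i,j,l)=\begin{cases}1& i+j<N\\ \zeta^{l(\epsilon(a)+2b)}& i+j\ge N\end{cases},\qquad t_s(i,j)=s^{-ij}\,\mathrm{id},\qquad f_s(i)=s^{-i^2},$$ where $\lambda_b(i,j,l)$ is the multiple of the canonical isomorphism between powers of $g$ used as $\lambda_{i,j,l}$. If they form a ribbon zesting, $(\lambda_a,\lambda_b,t_s,f_s)$ is called a cyclic ribbon zesting of $\mathcal C$. A superscript ${}^{\lambda,s}$ denotes an invariant computed in the zested category. **Invariants.** Let the braid generators act on three coloured strands by the braiding, with products of generators applied from right to left. For objects $X,Y,Z$ let $$W_{X,Y}=\theta_Y^{-1}\operatorname{Tr}\big(\sigma_1^{-2}\sigma_2\sigma_1^{-1}\sigma_2\big|_{X\otimes Y\otimes X}\big),\qquad B_{X,Y,Z}=\operatorname{Tr}\big((\sigma_1^{-1}\sigma_2)^3\big|_{X\otimes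 Y\otimes Z}\big),\qquad (5_2)_X=\operatorname{Tr}\big(\sigma_1^{-3}\sigma_2^{-1}\sigma_1\sigma_2^{-1}\big|_{X\otimes X\otimes X}\big)$$ be the invariants of the Whitehead link, the Borromean rings and the knot $5_2$, presented as braid closures with the blackboard framing. Here $\theta_Y^{-1}$ is inserted on the strand coloured by $Y$; it is a number when $Y$ is simple. **Proposition.** For every cyclic ribbon zesting $(\lambda_a,\lambda_b,t_s,f_s)$ of $\mathcal C$, all $0\le i,j,l<N$ and all objects $X_i\in\mathcal C_i$, $Y_j\in\mathcal C_j$, $Z_l\in\mathcal C_l$: 1. $W^{\lambda,s}_{X_i,Y_j}=s^{i^2+j^2}\,W_{X_i,Y_j}$; 2. $B^{\lambda,s}_{X_i,Y_j,Z_l}=B_{X_i,Y_j,Z_l}$; 3. $(5_2^{\lambda,s})_{X_i}=s^{4i^2}\,(5_2)_{X_i}$. -/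

import Mathlib

open CategoryTheory MonoidalCategory

universe v u w

namespace ZestedLinks

noncomputable section

set_option linter.unusedSectionVars false

/-! ## Ribbon categories, trace, and the three link invariants -/

/-- A twist `θ` on a braided monoidal category: a natural automorphism of the identity functor with
`θ_{X ⊗ Y} = (θ_X ⊗ θ_Y) ∘ c_{Y,X} ∘ c_{X,Y}`. -/
class BalancedCategory (C : Type u) [Category.{v} C] [MonoidalCategory C] [BraidedCategory C] where
  /-- The twist `θ_X`. -/
  twist (X : C) : X ≅ X
  twist_naturality {X Y : C} (f : X ⟶ Y) : f ≫ (twist Y).hom = (twist X).hom ≫ f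
  twist_tensor (X Y : C) : (twist (X ⊗ Y)).hom =
    (β_ X Y).hom ≫ (β_ Y X).hom ≫ ((twist X).hom ⊗ₘ (twist Y).hom)

open BalancedCategory (twist)

/-- A ribbon category: a rigid braided category with a twist such that `(θ_X)^* = θ_{X^*}`. -/
class RibbonCategory (C : Type u) [Category.{v} C] [MonoidalCategory C] [BraidedCategory C]
    [RigidCategory C] extends BalancedCategory C where
  twist_dual (X : C) : rightAdjointMate (twist X).hom = (twist (Xᘁ)).hom

section Links

variable {C : Type u} [Category.{v} C] [MonoidalCategory C] [BraidedCategory C]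
  [BalancedCategory C]

/-- The (quantum) trace of an endomorphism,
`ev ∘ c_{X,X^*} ∘ ((θ_X ∘ f) ⊗ id) ∘ coev : 𝟙 ⟶ 𝟙`. -/
def trace {X : C} [HasRightDual X] (f : X ⟶ X) : 𝟙_ C ⟶ 𝟙_ C :=
  η_ X (Xᘁ) ≫ (f ≫ (twist X).hom) ▷ Xᘁ ≫ (β_ X (Xᘁ)).hom ≫ ε_ X (Xᘁ)

/-- The generator `σ₁` of the braid group on three strands, acting on coloured strands. -/
def sigma₁ (X Y Z : C) : (X ⊗ Y) ⊗ Z ≅ (Y ⊗ X) ⊗ Z :=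
  whiskerRightIso (β_ X Y) Z

/-- The generator `σ₂` of the braid group on three strands, acting on coloured strands. -/
def sigma₂ (X Y Z : C) : (X ⊗ Y) ⊗ Z ≅ (X ⊗ Z) ⊗ Y :=
  α_ X Y Z ≪≫ whiskerLeftIso X (β_ Y Z) ≪≫ (α_ X Z Y).symm

/-- The braid `σ₁⁻² σ₂ σ₁⁻¹ σ₂` coloured by `X, Y, X`; its closure is the Whitehead link. -/
def whiteheadBraid (X Y : C) : (X ⊗ Y) ⊗ X ⟶ (X ⊗ Y) ⊗ X :=
  (sigma₂ X Y X).hom ≫ (sigma₁ X X Y).inv ≫ (sigma₂ X X Y).hom ≫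
    (sigma₁ Y X X).inv ≫ (sigma₁ X Y X).inv

/-- The braid `(σ₁⁻¹ σ₂)³` coloured by `X, Y, Z`; its closure is the Borromean rings. -/
def borromeanBraid (X Y Z : C) : (X ⊗ Y) ⊗ Z ⟶ (X ⊗ Y) ⊗ Z :=
  (sigma₂ X Y Z).hom ≫ (sigma₁ Z X Y).inv ≫ (sigma₂ Z X Y).hom ≫
    (sigma₁ Y Z X).inv ≫ (sigma₂ Y Z X).hom ≫ (sigma₁ X Y Z).inv

/-- The braid `σ₁⁻³ σ₂⁻¹ σ₁ σ₂⁻¹` coloured by `X`; its closure is the knot `5₂`. -/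
def fiveTwoBraid (X : C) : (X ⊗ X) ⊗ X ⟶ (X ⊗ X) ⊗ X :=
  (sigma₂ X X X).inv ≫ (sigma₁ X X X).hom ≫ (sigma₂ X X X).inv ≫
    (sigma₁ X X X).inv ≫ (sigma₁ X X X).inv ≫ (sigma₁ X X X).inv

variable [RightRigidCategory C]

/-- The entry `W_{X,Y} = θ_Y⁻¹ Tr(σ₁⁻² σ₂ σ₁⁻¹ σ₂)` of the `W`-matrix: the factor `θ_Y⁻¹`, a number
when `Y` is simple, is inserted on the strand coloured by `Y` (a framing change of that
component), which makes sense for every object `Y`. -/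
def whiteheadInvariant (X Y : C) : 𝟙_ C ⟶ 𝟙_ C :=
  trace ((X ◁ (twist Y).inv) ▷ X ≫ whiteheadBraid X Y)

/-- The entry `B_{X,Y,Z}` of the Borromean tensor. -/
def borromeanInvariant (X Y Z : C) : 𝟙_ C ⟶ 𝟙_ C :=
  trace (borromeanBraid X Y Z)

/-- The invariant `(5₂)_X` of the knot `5₂` (with the blackboard framing of the braid closure). -/
def fiveTwoInvariant (X : C) : 𝟙_ C ⟶ 𝟙_ C :=
  trace (fiveTwoBraid X)

end Links

/-! ## String calculus behind the zested associator and braiding -/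

section StringCalculus

variable {C : Type u} [Category.{v} C] [MonoidalCategory C]

theorem zigzag_idempotent {X D : C} (η : 𝟙_ C ⟶ X ⊗ D) (ε : D ⊗ X ⟶ 𝟙_ C)
    (h : η ▷ X ≫ (α_ X D X).hom ≫ X ◁ ε = (λ_ X).hom ≫ (ρ_ X).inv) :
    (D ◁ η ≫ (α_ D X D).inv ≫ ε ▷ D) ≫ (λ_ D).hom ≫ (ρ_ D).inv ≫
      (D ◁ η ≫ (α_ D X D).inv ≫ ε ▷ D) = D ◁ η ≫ (α_ D X D).inv ≫ ε ▷ D := by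
  calc (D ◁ η ≫ (α_ D X D).inv ≫ ε ▷ D) ≫ (λ_ D).hom ≫ (ρ_ D).inv ≫
        (D ◁ η ≫ (α_ D X D).inv ≫ ε ▷ D) =
      𝟙 _ ⊗≫ D ◁ η ⊗≫ (ε ▷ (D ⊗ 𝟙_ C) ≫ 𝟙_ C ◁ D ◁ η) ⊗≫ ε ▷ D ⊗≫ 𝟙 _ := by
        monoidal
    _ = 𝟙 _ ⊗≫ D ◁ (η ▷ 𝟙_ C ≫ (X ⊗ D) ◁ η) ⊗≫
        (ε ▷ (D ⊗ X) ≫ 𝟙_ C ◁ ε) ▷ D ⊗≫ 𝟙 _ := by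
        rw [← whisker_exchange]; monoidal
    _ = 𝟙 _ ⊗≫ D ◁ η ⊗≫ D ◁ (η ▷ X ≫ (α_ X D X).hom ≫ X ◁ ε) ▷ D ⊗≫ ε ▷ D ⊗≫ 𝟙 _ := by
        rw [← whisker_exchange, ← whisker_exchange]; monoidal
    _ = _ := by
        rw [h]; monoidal

/-- A pairing satisfying one zigzag identity, for which the other zigzag is invertible, is exact. -/
abbrev exactPairingOfIsIso {X D : C} (η : 𝟙_ C ⟶ X ⊗ D) (ε : D ⊗ X ⟶ 𝟙_ C)
    (h : η ▷ X ≫ (α_ X D X).hom ≫ X ◁ ε = (λ_ X).hom ≫ (ρ_ X).inv)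
    (h' : IsIso (D ◁ η ≫ (α_ D X D).inv ≫ ε ▷ D)) : ExactPairing X D where
  coevaluation' := η
  evaluation' := ε
  evaluation_coevaluation' := h
  coevaluation_evaluation' := by
    have e := zigzag_idempotent η ε h
    set f := D ◁ η ≫ (α_ D X D).inv ≫ ε ▷ D with hf
    have : f ≫ ((λ_ D).hom ≫ (ρ_ D).inv ≫ f) = f ≫ 𝟙 _ := by rw [e, Category.comp_id]
    rw [cancel_epi] at this
    rw [← cancel_epi ((λ_ D).hom ≫ (ρ_ D).inv), Category.assoc, this]
    simp

/-- The isomorphism between `K ⊗ L'` and the unit used in the evaluation of the zested dual. -/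
def zMu {K L L' P R : C} (κ : 𝟙_ C ≅ K ⊗ L) (φ : L ⊗ P ≅ L' ⊗ R) (p : P ≅ 𝟙_ C) (r : R ≅ 𝟙_ C) :
    K ⊗ L' ≅ 𝟙_ C :=
  (ρ_ (K ⊗ L')).symm ≪≫ whiskerLeftIso (K ⊗ L') r.symm ≪≫ α_ K L' R ≪≫ whiskerLeftIso K φ.symm ≪≫
    (α_ K L P).symm ≪≫ whiskerRightIso κ.symm P ≪≫ λ_ P ≪≫ p

theorem zMu_spec {K L L' P R : C} (κ : 𝟙_ C ≅ K ⊗ L) (φ : L ⊗ P ≅ L' ⊗ R) (p : P ≅ 𝟙_ C)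
    (r : R ≅ 𝟙_ C) : (λ_ P).inv ≫ κ.hom ▷ P ≫ (α_ K L P).hom ≫ K ◁ φ.hom ≫ (α_ K L' R).inv ≫
      (zMu κ φ p r).hom ▷ R ≫ (λ_ R).hom ≫ r.hom = p.hom := by
  have e : (zMu κ φ p r).hom ▷ R ≫ (λ_ R).hom ≫ r.hom =
      (K ⊗ L') ◁ r.hom ≫ (ρ_ _).hom ≫ (zMu κ φ p r).hom := by
    rw [← leftUnitor_naturality, ← whisker_exchange_assoc, ← rightUnitor_naturality,
      unitors_equal]
  rw [e]
  simp [zMu]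

variable [BraidedCategory C]

/-- Passes the strand `L` under the strand `Z` and then applies `φ`. -/
def zAssoc (X Y Z : C) {L L' M M' : C} (φ : L ⊗ L' ⟶ M ⊗ M') :
    (((X ⊗ Y) ⊗ L) ⊗ Z) ⊗ L' ⟶ (X ⊗ ((Y ⊗ Z) ⊗ M)) ⊗ M' :=
  𝟙 _ ⊗≫ (X ⊗ Y) ◁ (β_ Z L).inv ▷ L' ⊗≫ (X ⊗ Y ⊗ Z) ◁ φ ⊗≫ 𝟙 _

/-- Applies `ψ` and then passes the strand `L` back under the strand `Z`. -/
def zAssocInv (X Y Z : C) {L L' M M' : C} (ψ : M ⊗ M' ⟶ L ⊗ L') :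
    (X ⊗ ((Y ⊗ Z) ⊗ M)) ⊗ M' ⟶ (((X ⊗ Y) ⊗ L) ⊗ Z) ⊗ L' :=
  𝟙 _ ⊗≫ (X ⊗ Y ⊗ Z) ◁ ψ ⊗≫ (X ⊗ Y) ◁ (β_ Z L).hom ▷ L' ⊗≫ 𝟙 _

theorem zAssoc_zAssocInv (X Y Z : C) {L L' M M' : C} (φ : L ⊗ L' ⟶ M ⊗ M')
    (ψ : M ⊗ M' ⟶ L ⊗ L') (h : φ ≫ ψ = 𝟙 _) : zAssoc X Y Z φ ≫ zAssocInv X Y Z ψ = 𝟙 _ := by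
  calc zAssoc X Y Z φ ≫ zAssocInv X Y Z ψ =
      𝟙 _ ⊗≫ (X ⊗ Y) ◁ (β_ Z L).inv ▷ L' ⊗≫ (X ⊗ Y ⊗ Z) ◁ (φ ≫ ψ) ⊗≫
        (X ⊗ Y) ◁ (β_ Z L).hom ▷ L' ⊗≫ 𝟙 _ := by
        simp only [zAssoc, zAssocInv]; monoidal
    _ = 𝟙 _ ⊗≫ (X ⊗ Y) ◁ ((β_ Z L).inv ≫ (β_ Z L).hom) ▷ L' ⊗≫ 𝟙 _ := by
        rw [h]; monoidal
    _ = _ := by rw [Iso.inv_hom_id]; monoidal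

theorem zAssocInv_zAssoc (X Y Z : C) {L L' M M' : C} (φ : L ⊗ L' ⟶ M ⊗ M')
    (ψ : M ⊗ M' ⟶ L ⊗ L') (h : ψ ≫ φ = 𝟙 _) : zAssocInv X Y Z ψ ≫ zAssoc X Y Z φ = 𝟙 _ := by
  calc zAssocInv X Y Z ψ ≫ zAssoc X Y Z φ =
      𝟙 _ ⊗≫ (X ⊗ Y ⊗ Z) ◁ ψ ⊗≫ (X ⊗ Y) ◁ ((β_ Z L).hom ≫ (β_ Z L).inv) ▷ L' ⊗≫
        (X ⊗ Y ⊗ Z) ◁ φ ⊗≫ 𝟙 _ := by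
        simp only [zAssoc, zAssocInv]; monoidal
    _ = 𝟙 _ ⊗≫ (X ⊗ Y ⊗ Z) ◁ (ψ ≫ φ) ⊗≫ 𝟙 _ := by
        rw [Iso.hom_inv_id]; monoidal
    _ = _ := by rw [h]; monoidal

/-- The zested associator as an isomorphism. -/
def zAssocIso (X Y Z : C) {L L' M M' : C} (φ : L ⊗ L' ≅ M ⊗ M') :
    (((X ⊗ Y) ⊗ L) ⊗ Z) ⊗ L' ≅ (X ⊗ ((Y ⊗ Z) ⊗ M)) ⊗ M' where
  hom := zAssoc X Y Z φ.hom
  inv := zAssocInv X Y Z φ.inv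
  hom_inv_id := zAssoc_zAssocInv X Y Z _ _ φ.hom_inv_id
  inv_hom_id := zAssocInv_zAssoc X Y Z _ _ φ.inv_hom_id

theorem zAssoc_naturality {X X' Y Y' Z Z' : C} (f : X ⟶ X') (g : Y ⟶ Y') (h : Z ⟶ Z')
    {L L' M M' : C} (φ : L ⊗ L' ⟶ M ⊗ M') :
    (((((f ⊗ₘ g) ⊗ₘ 𝟙 L) ⊗ₘ h) ⊗ₘ 𝟙 L') ≫ zAssoc X' Y' Z' φ) =
      zAssoc X Y Z φ ≫ ((f ⊗ₘ ((g ⊗ₘ h) ⊗ₘ 𝟙 M)) ⊗ₘ 𝟙 M') := by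
  calc ((((f ⊗ₘ g) ⊗ₘ 𝟙 L) ⊗ₘ h) ⊗ₘ 𝟙 L') ≫ zAssoc X' Y' Z' φ =
      𝟙 _ ⊗≫ (f ⊗ₘ g) ▷ (L ⊗ Z ⊗ L') ⊗≫ (X' ⊗ Y') ◁ (L ◁ h ≫ (β_ Z' L).inv) ▷ L' ⊗≫
        (X' ⊗ Y' ⊗ Z') ◁ φ ⊗≫ 𝟙 _ := by
        simp only [zAssoc, MonoidalCategory.tensorHom_def]; monoidal
    _ = 𝟙 _ ⊗≫ ((f ⊗ₘ g) ▷ ((L ⊗ Z) ⊗ L') ≫ (X' ⊗ Y') ◁ ((β_ Z L).inv ▷ L')) ⊗≫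
        (X' ⊗ Y') ◁ (h ▷ (L ⊗ L') ≫ Z' ◁ φ) ⊗≫ 𝟙 _ := by
        rw [BraidedCategory.braiding_inv_naturality_right]; monoidal
    _ = 𝟙 _ ⊗≫ (X ⊗ Y) ◁ ((β_ Z L).inv ▷ L') ⊗≫ (f ⊗ₘ g) ▷ (Z ⊗ L ⊗ L') ⊗≫
        ((X' ⊗ Y') ⊗ Z) ◁ φ ⊗≫ (X' ⊗ Y') ◁ h ▷ (M ⊗ M') ⊗≫ 𝟙 _ := by
        rw [← whisker_exchange, ← whisker_exchange]; monoidal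
    _ = 𝟙 _ ⊗≫ (X ⊗ Y) ◁ ((β_ Z L).inv ▷ L') ⊗≫ ((f ⊗ₘ g) ▷ (Z ⊗ L ⊗ L') ≫
        (X' ⊗ Y') ◁ (Z ◁ φ)) ⊗≫ (X' ⊗ Y') ◁ h ▷ (M ⊗ M') ⊗≫ 𝟙 _ := by
        monoidal
    _ = _ := by
        rw [← whisker_exchange]
        simp only [zAssoc, MonoidalCategory.tensorHom_def]; monoidal

/-- The braiding tensored with `τ`. -/
def zBraid (X Y : C) {L L' : C} (τ : L ⟶ L') : (X ⊗ Y) ⊗ L ⟶ (Y ⊗ X) ⊗ L' :=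
  (β_ X Y).hom ⊗ₘ τ

theorem zBraid_hexagon_forward (X Y Z : C) {L1 L2 M1 M2 N1 P Q R S T : C}
    (φ₁ : L1 ⊗ L2 ⟶ M1 ⊗ M2) (τ : M2 ⟶ N1) (φ₂ : M1 ⊗ N1 ⟶ S ⊗ T)
    (τ₁ : L1 ⟶ P) (c₁ : L2 ⟶ Q) {R' : C} (φ₃ : P ⊗ Q ⟶ R ⊗ R') (τ₂ : R ⟶ S) (c₂ : R' ⟶ T)
    (h : φ₁ ≫ M1 ◁ τ ≫ φ₂ = (τ₁ ⊗ₘ c₁) ≫ φ₃ ≫ (τ₂ ⊗ₘ c₂)) :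
    zAssoc X Y Z φ₁ ≫ zBraid X ((Y ⊗ Z) ⊗ M1) τ ≫ zAssoc Y Z X φ₂ =
      (zBraid X Y τ₁ ▷ Z ⊗ₘ c₁) ≫ zAssoc Y X Z φ₃ ≫ (Y ◁ zBraid X Z τ₂ ⊗ₘ c₂) := by
  have hl : zAssoc X Y Z φ₁ ≫ zBraid X ((Y ⊗ Z) ⊗ M1) τ ≫ zAssoc Y Z X φ₂ =
      𝟙 _ ⊗≫ (X ⊗ Y) ◁ (β_ Z L1).inv ▷ L2 ⊗≫ (β_ X Y).hom ▷ (Z ⊗ L1 ⊗ L2) ⊗≫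
       Y ◁ (β_ X Z).hom ▷ (L1 ⊗ L2) ⊗≫ (Y ⊗ Z ⊗ X) ◁ (φ₁ ≫ M1 ◁ τ ≫ φ₂) ⊗≫ 𝟙 _ := by
    calc zAssoc X Y Z φ₁ ≫ zBraid X ((Y ⊗ Z) ⊗ M1) τ ≫ zAssoc Y Z X φ₂ =
        𝟙 _ ⊗≫ (X ⊗ Y) ◁ (β_ Z L1).inv ▷ L2 ⊗≫ ((X ⊗ Y ⊗ Z) ◁ φ₁ ≫ 
        (β_ X (Y ⊗ Z)).hom ▷ (M1 ⊗ M2)) ⊗≫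
        (Y ⊗ Z) ◁ (((β_ X M1).hom ▷ M2) ≫ (M1 ⊗ X) ◁ τ) ⊗≫ 
        (Y ⊗ Z) ◁ (β_ X M1).inv ▷ N1 ⊗≫ (Y ⊗ Z ⊗ X) ◁ φ₂ ⊗≫ 𝟙 _ := by
          rw [zBraid, BraidedCategory.braiding_tensor_right_hom X (Y ⊗ Z) M1, zAssoc, zAssoc,
            MonoidalCategory.tensorHom_def]
          monoidal
      _ = 𝟙 _ ⊗≫ (X ⊗ Y) ◁ (β_ Z L1).inv ▷ L2 ⊗≫ (β_ X (Y ⊗ Z)).hom ▷ (L1 ⊗ L2) ⊗≫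
          (Y ⊗ Z ⊗ X) ◁ φ₁ ⊗≫ (Y ⊗ Z) ◁ ((X ⊗ M1) ◁ τ) ⊗≫
          (Y ⊗ Z) ◁ ((β_ X M1).hom ≫ (β_ X M1).inv) ▷ N1 ⊗≫ (Y ⊗ Z ⊗ X) ◁ φ₂ ⊗≫ 𝟙 _ := by
          rw [whisker_exchange (β_ X (Y ⊗ Z)).hom φ₁, ← whisker_exchange (β_ X M1).hom τ]
          monoidal
      _ = _ := by
          rw [Iso.hom_inv_id, BraidedCategory.braiding_tensor_right_hom]
          monoidal
  have hr : (zBraid X Y τ₁ ▷ Z ⊗ₘ c₁) ≫ zAssoc Y X Z φ₃ ≫ (Y ◁ zBraid X Z τ₂ ⊗ₘ c₂) = 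
      𝟙 _ ⊗≫ (X ⊗ Y) ◁ (β_ Z L1).inv ▷ L2 ⊗≫ (β_ X Y).hom ▷ (Z ⊗ L1 ⊗ L2) ⊗≫
       Y ◁ (β_ X Z).hom ▷ (L1 ⊗ L2) ⊗≫
       (Y ⊗ Z ⊗ X) ◁ ((τ₁ ⊗ₘ c₁) ≫ φ₃ ≫ (τ₂ ⊗ₘ c₂)) ⊗≫ 𝟙 _ := by
    calc (zBraid X Y τ₁ ▷ Z ⊗ₘ c₁) ≫ zAssoc Y X Z φ₃ ≫ (Y ◁ zBraid X Z τ₂ ⊗ₘ c₂) =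
        𝟙 _ ⊗≫ (β_ X Y).hom ▷ (L1 ⊗ Z ⊗ L2) ⊗≫ (Y ⊗ X) ◁ (τ₁ ▷ Z) ▷ L2 ⊗≫ 
         (Y ⊗ X) ◁ ((P ⊗ Z) ◁ c₁ ≫ (β_ Z P).inv ▷ Q) ⊗≫
         Y ◁ ((X ⊗ Z) ◁ φ₃ ≫ (β_ X Z).hom ▷ (R ⊗ R')) ⊗≫ 
         (Y ⊗ Z ⊗ X) ◁ (τ₂ ⊗ₘ c₂) ⊗≫ 𝟙 _ := by
          simp only [zBraid, zAssoc, MonoidalCategory.tensorHom_def]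
          monoidal
      _ = 𝟙 _ ⊗≫ (β_ X Y).hom ▷ (L1 ⊗ Z ⊗ L2) ⊗≫ 
         (Y ⊗ X) ◁ (τ₁ ▷ Z ≫ (β_ Z P).inv) ▷ L2 ⊗≫
         Y ◁ ((X ⊗ Z) ◁ (P ◁ c₁) ≫ (β_ X Z).hom ▷ (P ⊗ Q)) ⊗≫ (Y ⊗ Z ⊗ X) ◁ φ₃ ⊗≫ 
         (Y ⊗ Z ⊗ X) ◁ (τ₂ ⊗ₘ c₂) ⊗≫ 𝟙 _ := by
          rw [whisker_exchange, whisker_exchange]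
          monoidal
      _ = 𝟙 _ ⊗≫ ((β_ X Y).hom ▷ ((L1 ⊗ Z) ⊗ L2) ≫ 
         (Y ⊗ X) ◁ ((β_ Z L1).inv ▷ L2)) ⊗≫ Y ◁ ((X ⊗ Z) ◁ (τ₁ ▷ L2) ≫ (β_ X Z).hom ▷ (P ⊗ L2)) ⊗≫
         (Y ⊗ Z ⊗ X) ◁ (P ◁ c₁) ⊗≫ (Y ⊗ Z ⊗ X) ◁ φ₃ ⊗≫ 
         (Y ⊗ Z ⊗ X) ◁ (τ₂ ⊗ₘ c₂) ⊗≫ 𝟙 _ := by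
          rw [BraidedCategory.braiding_inv_naturality_left, whisker_exchange]
          monoidal
      _ = _ := by
          rw [whisker_exchange, ← whisker_exchange]
          simp only [MonoidalCategory.tensorHom_def]
          monoidal
  rw [hl, hr, h]

theorem zBraid_hexagon_reverse (X Y Z : C) {L1 L2 M1 M2 N2 P Q R S T R' : C}
    (ψ₁ : M1 ⊗ M2 ⟶ L1 ⊗ L2) (τ : L2 ⟶ N2) (ψ₂ : L1 ⊗ N2 ⟶ S ⊗ T)
    (τ₁ : M1 ⟶ P) (c₁ : M2 ⟶ Q) (ψ₃ : P ⊗ Q ⟶ R ⊗ R') (τ₂ : R ⟶ S) (c₂ : R' ⟶ T)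
    (h : Z ◁ ψ₁ ≫ (α_ _ _ _).inv ≫ ((β_ Z L1).hom ≫ (β_ L1 Z).hom) ▷ L2 ≫ (α_ _ _ _).hom ≫
        Z ◁ (L1 ◁ τ ≫ ψ₂) = Z ◁ ((τ₁ ⊗ₘ c₁) ≫ ψ₃ ≫ (τ₂ ⊗ₘ c₂))) :
    zAssocInv X Y Z ψ₁ ≫ zBraid ((X ⊗ Y) ⊗ L1) Z τ ≫ zAssocInv Z X Y ψ₂ =
      (X ◁ zBraid Y Z τ₁ ⊗ₘ c₁) ≫ zAssocInv X Z Y ψ₃ ≫ (zBraid X Z τ₂ ▷ Y ⊗ₘ c₂) := by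
  have hl : zAssocInv X Y Z ψ₁ ≫ zBraid ((X ⊗ Y) ⊗ L1) Z τ ≫ zAssocInv Z X Y ψ₂ =
      𝟙 _ ⊗≫ (X ⊗ Y) ◁ (Z ◁ ψ₁ ≫ (α_ _ _ _).inv ≫ ((β_ Z L1).hom ≫ (β_ L1 Z).hom) ▷ L2 ≫
        (α_ _ _ _).hom ≫ Z ◁ (L1 ◁ τ ≫ ψ₂)) ⊗≫ X ◁ (β_ Y Z).hom ▷ (S ⊗ T) ⊗≫
        (β_ X Z).hom ▷ (Y ⊗ S ⊗ T) ⊗≫ (Z ⊗ X) ◁ (β_ Y S).hom ▷ T ⊗≫ 𝟙 _ := by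
    calc zAssocInv X Y Z ψ₁ ≫ zBraid ((X ⊗ Y) ⊗ L1) Z τ ≫ zAssocInv Z X Y ψ₂ =
        𝟙 _ ⊗≫ (X ⊗ Y ⊗ Z) ◁ ψ₁ ⊗≫ (X ⊗ Y) ◁ ((β_ Z L1).hom ≫ (β_ L1 Z).hom) ▷ L2 ⊗≫
        ((β_ (X ⊗ Y) Z).hom ▷ (L1 ⊗ L2) ≫ (Z ⊗ X ⊗ Y) ◁ (L1 ◁ τ ≫ ψ₂)) ⊗≫
        (Z ⊗ X) ◁ (β_ Y S).hom ▷ T ⊗≫ 𝟙 _ := by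
          rw [zBraid, BraidedCategory.braiding_tensor_left_hom (X ⊗ Y) L1 Z, zAssocInv, zAssocInv,
            MonoidalCategory.tensorHom_def]
          monoidal
      _ = _ := by
          rw [← whisker_exchange, BraidedCategory.braiding_tensor_left_hom]
          monoidal
  have hr : (X ◁ zBraid Y Z τ₁ ⊗ₘ c₁) ≫ zAssocInv X Z Y ψ₃ ≫ (zBraid X Z τ₂ ▷ Y ⊗ₘ c₂) =
      𝟙 _ ⊗≫ (X ⊗ Y) ◁ (Z ◁ ((τ₁ ⊗ₘ c₁) ≫ ψ₃ ≫ (τ₂ ⊗ₘ c₂))) ⊗≫ X ◁ (β_ Y Z).hom ▷ (S ⊗ T) ⊗≫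
        (β_ X Z).hom ▷ (Y ⊗ S ⊗ T) ⊗≫ (Z ⊗ X) ◁ (β_ Y S).hom ▷ T ⊗≫ 𝟙 _ := by
    calc (X ◁ zBraid Y Z τ₁ ⊗ₘ c₁) ≫ zAssocInv X Z Y ψ₃ ≫ (zBraid X Z τ₂ ▷ Y ⊗ₘ c₂) =
        𝟙 _ ⊗≫ X ◁ ((β_ Y Z).hom ▷ (M1 ⊗ M2) ≫ (Z ⊗ Y) ◁ ((τ₁ ⊗ₘ c₁) ≫ ψ₃)) ⊗≫ 
        ((X ⊗ Z) ◁ ((β_ Y R).hom ▷ R') ≫ (β_ X Z).hom ▷ ((R ⊗ Y) ⊗ R')) ⊗≫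
        (Z ⊗ X) ◁ (τ₂ ▷ Y ▷ R' ≫ (S ⊗ Y) ◁ c₂) ⊗≫ 𝟙 _ := by
          simp only [zBraid, zAssocInv, MonoidalCategory.tensorHom_def]
          monoidal
      _ = 𝟙 _ ⊗≫ X ◁ ((Y ⊗ Z) ◁ ((τ₁ ⊗ₘ c₁) ≫ ψ₃)) ⊗≫ X ◁ (β_ Y Z).hom ▷ (R ⊗ R') ⊗≫
        (β_ X Z).hom ▷ (Y ⊗ R ⊗ R') ⊗≫
        (Z ⊗ X) ◁ (((β_ Y R).hom ≫ τ₂ ▷ Y) ▷ R' ≫ (S ⊗ Y) ◁ c₂) ⊗≫ 𝟙 _ := by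
          rw [← whisker_exchange, whisker_exchange (β_ X Z).hom]
          monoidal
      _ = 𝟙 _ ⊗≫ X ◁ ((Y ⊗ Z) ◁ ((τ₁ ⊗ₘ c₁) ≫ ψ₃)) ⊗≫ X ◁ (β_ Y Z).hom ▷ (R ⊗ R') ⊗≫
        ((β_ X Z).hom ▷ (Y ⊗ R ⊗ R') ≫ (Z ⊗ X) ◁ (Y ◁ τ₂ ▷ R' ≫ Y ◁ S ◁ c₂)) ⊗≫
        (Z ⊗ X) ◁ ((β_ Y S).hom ▷ T) ⊗≫ 𝟙 _ := by
          rw [← BraidedCategory.braiding_naturality_right]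
          have e : ((β_ Y S).hom ▷ R') ≫ (S ⊗ Y) ◁ c₂ = (Y ⊗ S) ◁ c₂ ≫ (β_ Y S).hom ▷ T :=
            (whisker_exchange _ _).symm
          rw [comp_whiskerRight, Category.assoc, e]
          monoidal
      _ = 𝟙 _ ⊗≫ X ◁ ((Y ⊗ Z) ◁ ((τ₁ ⊗ₘ c₁) ≫ ψ₃)) ⊗≫
        X ◁ ((β_ Y Z).hom ▷ (R ⊗ R') ≫ (Z ⊗ Y) ◁ (τ₂ ⊗ₘ c₂)) ⊗≫
        (β_ X Z).hom ▷ (Y ⊗ S ⊗ T) ⊗≫ 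
        (Z ⊗ X) ◁ ((β_ Y S).hom ▷ T) ⊗≫ 𝟙 _ := by
          rw [← whisker_exchange]
          simp only [MonoidalCategory.tensorHom_def]
          monoidal
      _ = _ := by
          rw [← whisker_exchange]
          monoidal
  rw [hl, hr, h]

theorem zAssoc_triangle (X Y : C) {L1 L2 M1 M2 K : C} (φ : L1 ⊗ L2 ⟶ M1 ⊗ M2) (l : M1 ⟶ 𝟙_ C)
   (r : L1 ⟶ 𝟙_ C) (c₁ : L2 ⟶ K) (c₂ : M2 ⟶ K)
   (h : φ ≫ (l ⊗ₘ c₂) = (r ⊗ₘ c₁)) :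
   zAssoc X (𝟙_ C) Y φ ≫ (X ◁ (((λ_ Y).hom ⊗ₘ l) ≫ (ρ_ Y).hom) ⊗ₘ c₂) = 
    ((((ρ_ X).hom ⊗ₘ r) ≫ (ρ_ X).hom) ▷ Y ⊗ₘ c₁) := by
  calc zAssoc X (𝟙_ C) Y φ ≫ (X ◁ (((λ_ Y).hom ⊗ₘ l) ≫ (ρ_ Y).hom) ⊗ₘ c₂) =
      𝟙 _ ⊗≫ X ◁ ((β_ Y L1).inv) ▷ L2 ⊗≫ (X ⊗ Y) ◁ (φ ≫ (l ⊗ₘ c₂)) ⊗≫ 𝟙 _ := by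
        simp only [zAssoc, MonoidalCategory.tensorHom_def]
        monoidal
    _ = 𝟙 _ ⊗≫ X ◁ ((β_ Y L1).inv ≫ Y ◁ r) ▷ L2 ⊗≫ (X ⊗ Y) ◁ c₁ ⊗≫ 𝟙 _ := by
        rw [h]
        simp only [MonoidalCategory.tensorHom_def]
        monoidal
    _ = _ := by
        rw [← BraidedCategory.braiding_inv_naturality_left,
          braiding_inv_tensorUnit_right]
        simp only [MonoidalCategory.tensorHom_def]
        monoidal

theorem zAssoc_pentagon (X Y Z W : C) {L1 L2 L3 L3' M1 M2 M3 M4 N1 N2 N3 K : C}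
    (φ₁ : L1 ⊗ L2 ⟶ M1 ⊗ M2) (c₁ : L3 ⟶ L3') (φ₂ : M2 ⊗ L3' ⟶ M3 ⊗ M4)
    (φ₃ : M1 ⊗ M3 ⟶ N1 ⊗ N2) (c₂ : M4 ⟶ N3)
    (ψ₁ : L2 ⊗ L3 ⟶ N1 ⊗ K) (ψ₂ : L1 ⊗ K ⟶ N2 ⊗ N3)
    (h : φ₁ ▷ L3 ≫ (M1 ⊗ M2) ◁ c₁ ≫ (α_ _ _ _).hom ≫ M1 ◁ φ₂ ≫ (α_ _ _ _).inv ≫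
        φ₃ ▷ M4 ≫ (N1 ⊗ N2) ◁ c₂ =
      (α_ _ _ _).hom ≫ L1 ◁ ψ₁ ≫ (α_ _ _ _).inv ≫ (β_ N1 L1).inv ▷ K ≫ (α_ _ _ _).hom ≫
        N1 ◁ ψ₂ ≫ (α_ _ _ _).inv) :
    ((zAssoc X Y Z φ₁ ▷ W) ⊗ₘ c₁) ≫ zAssoc X ((Y ⊗ Z) ⊗ M1) W φ₂ ≫
        ((X ◁ zAssoc Y Z W φ₃) ⊗ₘ c₂) =
      zAssoc ((X ⊗ Y) ⊗ L1) Z W ψ₁ ≫ zAssoc X Y ((Z ⊗ W) ⊗ N1) ψ₂ := by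
  have hr : zAssoc ((X ⊗ Y) ⊗ L1) Z W ψ₁ ≫ zAssoc X Y ((Z ⊗ W) ⊗ N1) ψ₂ =
      𝟙 _ ⊗≫ (X ⊗ Y) ◁ (β_ Z L1).inv ▷ (L2 ⊗ W ⊗ L3) ⊗≫
        (X ⊗ Y ⊗ Z ⊗ L1) ◁ (β_ W L2).inv ▷ L3 ⊗≫
        (X ⊗ Y ⊗ Z) ◁ (β_ W L1).inv ▷ (L2 ⊗ L3) ⊗≫
        (X ⊗ Y ⊗ Z ⊗ W) ◁ ((α_ L1 L2 L3).hom ≫ L1 ◁ ψ₁ ≫ (α_ _ _ _).inv ≫ (β_ N1 L1).inv ▷ K ≫ (α_ _ _ _).hom ≫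
        N1 ◁ ψ₂ ≫ (α_ _ _ _).inv) ⊗≫ 𝟙 _ := by
    calc zAssoc ((X ⊗ Y) ⊗ L1) Z W ψ₁ ≫ zAssoc X Y ((Z ⊗ W) ⊗ N1) ψ₂ = 𝟙 _ ⊗≫ (X ⊗ Y) ◁ ((L1 ⊗ Z) ◁ ((α_ L2 W L3).inv ≫ (β_ W L2).inv ▷ L3 ≫ (α_ W L2 L3).hom ≫ W ◁ ψ₁) ≫ 
                (β_ Z L1).inv ▷ (W ⊗ N1 ⊗ K)) ⊗≫
          (X ⊗ Y ⊗ Z) ◁ (β_ W L1).inv ▷ (N1 ⊗ K) ⊗≫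
          (X ⊗ Y ⊗ Z ⊗ W) ◁ (β_ N1 L1).inv ▷ K ⊗≫
          (X ⊗ Y ⊗ Z ⊗ W ⊗ N1) ◁ ψ₂ ⊗≫ 𝟙 _ := by
            simp only [zAssoc, BraidedCategory.braiding_tensor_left_inv]
            monoidal
      _ = 𝟙 _ ⊗≫ (X ⊗ Y) ◁ ((β_ Z L1).inv ▷ (L2 ⊗ W ⊗ L3)) ⊗≫
          (X ⊗ Y ⊗ Z ⊗ L1) ◁ (β_ W L2).inv ▷ L3 ⊗≫
          (X ⊗ Y ⊗ Z) ◁ ((L1 ⊗ W) ◁ ψ₁ ≫ (β_ W L1).inv ▷ (N1 ⊗ K)) ⊗≫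
          (X ⊗ Y ⊗ Z ⊗ W) ◁ (β_ N1 L1).inv ▷ K ⊗≫
          (X ⊗ Y ⊗ Z ⊗ W ⊗ N1) ◁ ψ₂ ⊗≫ 𝟙 _ := by
            rw [whisker_exchange]
            monoidal
      _ = _ := by
            rw [whisker_exchange]
            monoidal
  have hl : ((zAssoc X Y Z φ₁ ▷ W) ⊗ₘ c₁) ≫ zAssoc X ((Y ⊗ Z) ⊗ M1) W φ₂ ≫
        ((X ◁ zAssoc Y Z W φ₃) ⊗ₘ c₂) =
      𝟙 _ ⊗≫ (X ⊗ Y) ◁ (β_ Z L1).inv ▷ (L2 ⊗ W ⊗ L3) ⊗≫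
        (X ⊗ Y ⊗ Z ⊗ L1) ◁ (β_ W L2).inv ▷ L3 ⊗≫
        (X ⊗ Y ⊗ Z) ◁ (β_ W L1).inv ▷ (L2 ⊗ L3) ⊗≫
        (X ⊗ Y ⊗ Z ⊗ W) ◁ (φ₁ ▷ L3 ≫ (M1 ⊗ M2) ◁ c₁ ≫ (α_ _ _ _).hom ≫ M1 ◁ φ₂ ≫ (α_ _ _ _).inv ≫
        φ₃ ▷ M4 ≫ (N1 ⊗ N2) ◁ c₂) ⊗≫ 𝟙 _ := by
    calc ((zAssoc X Y Z φ₁ ▷ W) ⊗ₘ c₁) ≫ zAssoc X ((Y ⊗ Z) ⊗ M1) W φ₂ ≫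
        ((X ◁ zAssoc Y Z W φ₃) ⊗ₘ c₂) = 𝟙 _ ⊗≫ (X ⊗ Y) ◁ (β_ Z L1).inv ▷ (L2 ⊗ W ⊗ L3) ⊗≫ (X ⊗ Y ⊗ Z) ◁ (φ₁ ▷ W) ▷ L3 ⊗≫
          (X ⊗ Y ⊗ Z ⊗ M1) ◁ ((M2 ⊗ W) ◁ c₁ ≫ (β_ W M2).inv ▷ L3')  ⊗≫
          (X ⊗ Y ⊗ Z) ◁ ((M1 ⊗ W) ◁ φ₂ ≫ (β_ W M1).inv ▷ (M3 ⊗ M4)) ⊗≫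
          (X ⊗ Y ⊗ Z ⊗ W) ◁ (φ₃ ▷ M4) ⊗≫ (X ⊗ Y ⊗ Z ⊗ W ⊗ N1 ⊗ N2) ◁ c₂ ⊗≫ 𝟙 _ := by
            simp only [zAssoc, MonoidalCategory.tensorHom_def]
            monoidal
      _ = 𝟙 _ ⊗≫ (X ⊗ Y) ◁ (β_ Z L1).inv ▷ (L2 ⊗ W ⊗ L3) ⊗≫ (X ⊗ Y ⊗ Z) ◁ (φ₁ ▷ W) ▷ L3 ⊗≫
          (X ⊗ Y ⊗ Z ⊗ M1) ◁ ((β_ W M2).inv ▷ L3) ⊗≫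
          (X ⊗ Y ⊗ Z) ◁ ((M1 ⊗ W) ◁ (M2 ◁ c₁) ≫ (β_ W M1).inv ▷ (M2 ⊗ L3')) ⊗≫
          (X ⊗ Y ⊗ Z ⊗ W) ◁ (M1 ◁ φ₂) ⊗≫ 
          (X ⊗ Y ⊗ Z ⊗ W) ◁ (φ₃ ▷ M4) ⊗≫ (X ⊗ Y ⊗ Z ⊗ W ⊗ N1 ⊗ N2) ◁ c₂ ⊗≫ 𝟙 _ := by
            rw [whisker_exchange, whisker_exchange]
            monoidal
      _ = 𝟙 _ ⊗≫ (X ⊗ Y) ◁ (β_ Z L1).inv ▷ (L2 ⊗ W ⊗ L3) ⊗≫ 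
          (X ⊗ Y ⊗ Z) ◁ (φ₁ ▷ W ≫ (β_ W (M1 ⊗ M2)).inv) ▷ L3 ⊗≫
          (X ⊗ Y ⊗ Z ⊗ W) ◁ (M1 ◁ M2 ◁ c₁) ⊗≫ (X ⊗ Y ⊗ Z ⊗ W) ◁ (M1 ◁ φ₂) ⊗≫ 
          (X ⊗ Y ⊗ Z ⊗ W) ◁ (φ₃ ▷ M4) ⊗≫ (X ⊗ Y ⊗ Z ⊗ W ⊗ N1 ⊗ N2) ◁ c₂ ⊗≫ 𝟙 _ := by
            rw [whisker_exchange, BraidedCategory.braiding_tensor_right_inv]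
            monoidal
      _ = _ := by
            rw [BraidedCategory.braiding_inv_naturality_left, BraidedCategory.braiding_tensor_right_inv]
            monoidal
  rw [hl, hr, h]

/-- The coevaluation of the zested dual. -/
def zCoev {X X' K L : C} (η : 𝟙_ C ⟶ X ⊗ X') (κ : 𝟙_ C ⟶ K ⊗ L) :
    𝟙_ C ⟶ (X ⊗ (X' ⊗ K)) ⊗ L :=
  η ⊗≫ (X ⊗ X') ◁ κ ⊗≫ 𝟙 _

/-- The evaluation of the zested dual. -/
def zEv {X X' K L' : C} (ε : X' ⊗ X ⟶ 𝟙_ C) (μ : K ⊗ L' ⟶ 𝟙_ C) :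
    ((X' ⊗ K) ⊗ X) ⊗ L' ⟶ 𝟙_ C :=
  𝟙 _ ⊗≫ X' ◁ (β_ X K).inv ▷ L' ⊗≫ ε ▷ (K ⊗ L') ⊗≫ μ

theorem z_zigzag₁ {X X' K L L' P P₀ R R₀ : C} (η : 𝟙_ C ⟶ X ⊗ X') (ε : X' ⊗ X ⟶ 𝟙_ C)
    (h : η ▷ X ≫ (α_ X X' X).hom ≫ X ◁ ε = (λ_ X).hom ≫ (ρ_ X).inv)
    (κ : 𝟙_ C ⟶ K ⊗ L) (μ : K ⊗ L' ⟶ 𝟙_ C) (φ : L ⊗ P ⟶ L' ⊗ R) (c₀ : P₀ ⟶ P) (c₁ : R ⟶ R₀)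
    (l : P₀ ⟶ 𝟙_ C) (r : R₀ ⟶ 𝟙_ C)
    (hμ : c₀ ≫ (λ_ P).inv ≫ κ ▷ P ≫ (α_ _ _ _).hom ≫ K ◁ φ ≫ (α_ _ _ _).inv ≫ μ ▷ R ≫
      (λ_ R).hom ≫ c₁ ≫ r = l) :
    (((zCoev η κ ▷ X) ⊗ₘ c₀) ≫ zAssoc X (X' ⊗ K) X φ ≫ ((X ◁ zEv ε μ) ⊗ₘ c₁)) ≫
      ((ρ_ X).hom ⊗ₘ r) ≫ (ρ_ X).hom = ((λ_ X).hom ⊗ₘ l) ≫ (ρ_ X).hom := by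
  calc (((zCoev η κ ▷ X) ⊗ₘ c₀) ≫ zAssoc X (X' ⊗ K) X φ ≫ ((X ◁ zEv ε μ) ⊗ₘ c₁)) ≫
      ((ρ_ X).hom ⊗ₘ r) ≫ (ρ_ X).hom =
      𝟙 _ ⊗≫ X ◁ c₀ ⊗≫ η ▷ (X ⊗ P) ⊗≫ (X ⊗ X') ◁ (κ ▷ X ⊗≫ K ◁ (β_ X L).inv) ▷ P ⊗≫
        (X ⊗ X') ◁ ((K ⊗ X) ◁ φ ≫ (β_ X K).inv ▷ (L' ⊗ R)) ⊗≫
        X ◁ (ε ▷ (K ⊗ L' ⊗ R)) ⊗≫ X ◁ μ ▷ R ⊗≫ X ◁ (c₁ ≫ r) ⊗≫ 𝟙 _ := by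
        rw [MonoidalCategory.tensorHom_def' (zCoev η κ ▷ X) c₀]
        simp only [zAssoc, zCoev, zEv, MonoidalCategory.tensorHom_def]
        monoidal
    _ = 𝟙 _ ⊗≫ X ◁ c₀ ⊗≫ η ▷ (X ⊗ P) ⊗≫ (X ⊗ X') ◁ (κ ▷ X ≫ (β_ X (K ⊗ L)).inv) ▷ P ⊗≫
        X ◁ ((X' ⊗ X) ◁ (K ◁ φ) ≫ ε ▷ (K ⊗ L' ⊗ R)) ⊗≫ X ◁ μ ▷ R ⊗≫ X ◁ (c₁ ≫ r) ⊗≫ 𝟙 _ := by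
        rw [whisker_exchange, BraidedCategory.braiding_tensor_right_inv]
        monoidal
    _ = 𝟙 _ ⊗≫ X ◁ c₀ ⊗≫ η ▷ (X ⊗ P) ⊗≫ 
        X ◁ ((X' ⊗ X) ◁ (κ ▷ P) ≫ ε ▷ ((K ⊗ L) ⊗ P)) ⊗≫ X ◁ (K ◁ φ) ⊗≫
        X ◁ μ ▷ R ⊗≫ X ◁ (c₁ ≫ r) ⊗≫ 𝟙 _ := by
        rw [whisker_exchange, BraidedCategory.braiding_inv_naturality_left,
          braiding_inv_tensorUnit_right]
        monoidal
    _ = 𝟙 _ ⊗≫ X ◁ c₀ ⊗≫ (η ▷ X ≫ (α_ X X' X).hom ≫ X ◁ ε) ▷ P ⊗≫ 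
        X ◁ (κ ▷ P) ⊗≫ X ◁ (K ◁ φ) ⊗≫
        X ◁ μ ▷ R ⊗≫ X ◁ (c₁ ≫ r) ⊗≫ 𝟙 _ := by
        rw [whisker_exchange]
        monoidal
    _ = 𝟙 _ ⊗≫ X ◁ (c₀ ≫ (λ_ P).inv ≫ κ ▷ P ≫ (α_ _ _ _).hom ≫ K ◁ φ ≫ (α_ _ _ _).inv ≫ μ ▷ R ≫
      (λ_ R).hom ≫ c₁ ≫ r) ⊗≫ 𝟙 _ := by
        rw [h]
        monoidal
    _ = _ := by
        rw [hμ]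
        simp only [MonoidalCategory.tensorHom_def]
        monoidal

theorem z_zigzag₂ {X X' K L L' P P₀ R R₀ : C} (η : 𝟙_ C ⟶ X ⊗ X') (ε : X' ⊗ X ⟶ 𝟙_ C)
    (h : X' ◁ η ≫ (α_ X' X X').inv ≫ ε ▷ X' = (ρ_ X').hom ≫ (λ_ X').inv)
    (κ : 𝟙_ C ⟶ K ⊗ L) (μ : K ⊗ L' ⟶ 𝟙_ C) (ψ : L ⊗ P ⟶ L' ⊗ R) (c₀ : P₀ ⟶ P) (c₁ : R ⟶ R₀) :
    ((((X' ⊗ K) ◁ zCoev η κ) ⊗ₘ c₀) ≫ zAssocInv (X' ⊗ K) X (X' ⊗ K) ψ ≫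
        ((zEv ε μ ▷ (X' ⊗ K)) ⊗ₘ c₁)) =
      𝟙 _ ⊗≫ X' ◁ (K ◁ c₀ ⊗≫ (K ◁ κ) ▷ P ⊗≫ (K ⊗ K) ◁ ψ ⊗≫ K ◁ (β_ K L').hom ▷ R ⊗≫
        μ ▷ (K ⊗ R) ⊗≫ K ◁ c₁) ⊗≫ 𝟙 _ := by
  calc ((((X' ⊗ K) ◁ zCoev η κ) ⊗ₘ c₀) ≫ zAssocInv (X' ⊗ K) X (X' ⊗ K) ψ ≫
        ((zEv ε μ ▷ (X' ⊗ K)) ⊗ₘ c₁)) =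
      𝟙 _ ⊗≫ X' ◁ K ◁ c₀ ⊗≫ X' ◁ (K ◁ η) ▷ P ⊗≫ (X' ⊗ K ⊗ X ⊗ X') ◁ (κ ▷ P ⊗≫ K ◁ ψ) ⊗≫
        (X' ⊗ K ⊗ X ⊗ X') ◁ (β_ K L').hom ▷ R ⊗≫
        X' ◁ (((K ⊗ X) ◁ (β_ X' L').hom ≫ (β_ X K).inv ▷ (L' ⊗ X')) ▷ (K ⊗ R)) ⊗≫
        (ε ▷ (K ⊗ L')) ▷ (X' ⊗ K ⊗ R) ⊗≫ μ ▷ (X' ⊗ K ⊗ R) ⊗≫ (X' ⊗ K) ◁ c₁ ⊗≫ 𝟙 _ := by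
        rw [MonoidalCategory.tensorHom_def' ((X' ⊗ K) ◁ zCoev η κ) c₀]
        simp only [zAssocInv, zCoev, zEv, MonoidalCategory.tensorHom_def,
          BraidedCategory.braiding_tensor_left_hom]
        monoidal
    _ = 𝟙 _ ⊗≫ X' ◁ K ◁ c₀ ⊗≫ X' ◁ ((K ◁ η) ▷ (𝟙_ C ⊗ P) ≫ (K ⊗ X ⊗ X') ◁ (κ ▷ P ⊗≫ K ◁ ψ)) ⊗≫
        X' ◁ ((K ⊗ X ⊗ X') ◁ ((β_ K L').hom ▷ R) ≫
          ((α_ K X X').inv ≫ (β_ X K).inv ▷ X') ▷ ((L' ⊗ K) ⊗ R)) ⊗≫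
        X' ◁ ((X ⊗ K) ◁ (β_ X' L').hom) ▷ (K ⊗ R) ⊗≫
        (ε ▷ (K ⊗ L')) ▷ (X' ⊗ K ⊗ R) ⊗≫ μ ▷ (X' ⊗ K ⊗ R) ⊗≫ (X' ⊗ K) ◁ c₁ ⊗≫ 𝟙 _ := by
        rw [whisker_exchange (β_ X K).inv]
        monoidal
    _ = 𝟙 _ ⊗≫ X' ◁ K ◁ c₀ ⊗≫ X' ◁ K ◁ (κ ▷ P ⊗≫ K ◁ ψ) ⊗≫
        X' ◁ ((K ◁ η) ▷ ((K ⊗ L') ⊗ R) ≫ (K ⊗ X ⊗ X') ◁ ((β_ K L').hom ▷ R)) ⊗≫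
        X' ◁ ((β_ X K).inv ▷ X') ▷ ((L' ⊗ K) ⊗ R) ⊗≫
        X' ◁ ((X ⊗ K) ◁ (β_ X' L').hom) ▷ (K ⊗ R) ⊗≫
        (ε ▷ (K ⊗ L')) ▷ (X' ⊗ K ⊗ R) ⊗≫ μ ▷ (X' ⊗ K ⊗ R) ⊗≫ (X' ⊗ K) ◁ c₁ ⊗≫ 𝟙 _ := by
        rw [← whisker_exchange]
        monoidal
    _ = 𝟙 _ ⊗≫ X' ◁ (K ◁ c₀ ⊗≫ (K ◁ κ) ▷ P ⊗≫ (K ⊗ K) ◁ ψ ⊗≫ K ◁ (β_ K L').hom ▷ R) ⊗≫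
        X' ◁ ((K ◁ η ≫ (β_ (X ⊗ X') K).inv) ⊗≫ X ◁ (β_ X' K).hom) ▷ ((L' ⊗ K) ⊗ R) ⊗≫
        X' ◁ ((X ⊗ K) ◁ (β_ X' L').hom) ▷ (K ⊗ R) ⊗≫
        (ε ▷ (K ⊗ L')) ▷ (X' ⊗ K ⊗ R) ⊗≫ μ ▷ (X' ⊗ K ⊗ R) ⊗≫ (X' ⊗ K) ◁ c₁ ⊗≫ 𝟙 _ := by
        have e : (K ◁ η ≫ (β_ (X ⊗ X') K).inv) ⊗≫ X ◁ (β_ X' K).hom =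
            K ◁ η ⊗≫ (β_ X K).inv ▷ X' ⊗≫ X ◁ ((β_ X' K).inv ≫ (β_ X' K).hom) ⊗≫ 𝟙 _ := by
          rw [BraidedCategory.braiding_tensor_left_inv]
          monoidal
        rw [← whisker_exchange, e, Iso.inv_hom_id]
        monoidal
    _ = 𝟙 _ ⊗≫ X' ◁ (K ◁ c₀ ⊗≫ (K ◁ κ) ▷ P ⊗≫ (K ⊗ K) ◁ ψ ⊗≫ K ◁ (β_ K L').hom ▷ R) ⊗≫
        X' ◁ η ▷ (K ⊗ L' ⊗ K ⊗ R) ⊗≫ ((X' ⊗ X) ◁ ((β_ X' (K ⊗ L')).hom) ≫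
          ε ▷ ((K ⊗ L') ⊗ X')) ▷ (K ⊗ R) ⊗≫
        μ ▷ (X' ⊗ K ⊗ R) ⊗≫ (X' ⊗ K) ◁ c₁ ⊗≫ 𝟙 _ := by
        rw [BraidedCategory.braiding_inv_naturality_right, braiding_inv_tensorUnit_left,
          BraidedCategory.braiding_tensor_right_hom]
        monoidal
    _ = 𝟙 _ ⊗≫ X' ◁ (K ◁ c₀ ⊗≫ (K ◁ κ) ▷ P ⊗≫ (K ⊗ K) ◁ ψ ⊗≫ K ◁ (β_ K L').hom ▷ R) ⊗≫
        (X' ◁ η ≫ (α_ X' X X').inv ≫ ε ▷ X') ▷ (K ⊗ L' ⊗ K ⊗ R) ⊗≫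
        ((β_ X' (K ⊗ L')).hom ≫ μ ▷ X') ▷ (K ⊗ R) ⊗≫ (X' ⊗ K) ◁ c₁ ⊗≫ 𝟙 _ := by
        rw [whisker_exchange]
        monoidal
    _ = _ := by
        rw [h, ← BraidedCategory.braiding_naturality_right, braiding_tensorUnit_right]
        monoidal


theorem z_zigzag₂_isIso {X X' K L L' P P₀ R R₀ : C} (η : 𝟙_ C ⟶ X ⊗ X') (ε : X' ⊗ X ⟶ 𝟙_ C)
    (h : X' ◁ η ≫ (α_ X' X X').inv ≫ ε ▷ X' = (ρ_ X').hom ≫ (λ_ X').inv)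
    (κ : 𝟙_ C ≅ K ⊗ L) (μ : K ⊗ L' ≅ 𝟙_ C) (ψ : L ⊗ P ≅ L' ⊗ R) (c₀ : P₀ ≅ P) (c₁ : R ≅ R₀) :
    IsIso ((((X' ⊗ K) ◁ zCoev η κ.hom) ⊗ₘ c₀.hom) ≫ zAssocInv (X' ⊗ K) X (X' ⊗ K) ψ.hom ≫
        ((zEv ε μ.hom ▷ (X' ⊗ K)) ⊗ₘ c₁.hom)) := by
  rw [z_zigzag₂ η ε h]
  simp only [monoidalComp]
  infer_instance

end StringCalculus

/-! ## Gradings and ribbon zestings -/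

section Zesting

variable (k : Type w) [Field k] (C : Type u) [Category.{v} C] [Abelian C] [Linear k C]
  [MonoidalCategory C]

attribute [local instance] Abelian.hasFiniteBiproducts

/-- A fusion category over `k`: semisimple with finitely many simple objects up to isomorphism,
finite-dimensional spaces of morphisms, and simple unit object (rigidity is a separate class). -/
class IsFusionCategory : Prop where
  finite_hom (X Y : C) : FiniteDimensional k (X ⟶ Y)
  semisimple (X : C) : ∃ (n : ℕ) (S : Fin n → C), (∀ i, Simple (S i)) ∧ Nonempty (X ≅ ⨁ S)
  finite_simple : ∃ (n : ℕ) (S : Fin n → C), ∀ X : C, Simple X → ∃ i, Nonempty (X ≅ S i)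
  simple_unit : Simple (𝟙_ C)

/-- A modular category: a ribbon fusion category with nondegenerate braiding, i.e. the only simple
object that centralizes every object is the unit. -/
class IsModularCategory [BraidedCategory C] [RigidCategory C] [RibbonCategory C] : Prop
    extends IsFusionCategory k C where
  nondegenerate (X : C) : Simple X → (∀ Y : C, (β_ X Y).hom ≫ (β_ Y X).hom = 𝟙 _) →
    Nonempty (X ≅ 𝟙_ C)

variable {k C} in
/-- The isomorphism `u • e` for a unit `u` of `k`. -/
def unitSmul {X Y : C} (u : kˣ) (e : X ≅ Y) : X ≅ Y where
  hom := (u : k) • e.hom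
  inv := ((u⁻¹ : kˣ) : k) • e.inv
  hom_inv_id := by simp [smul_smul]
  inv_hom_id := by simp [smul_smul]

/-- A grading `C = ⨁_{a ∈ A} C_a` of a monoidal category by a finite abelian group `A`. -/
structure Grading (A : Type) [AddCommGroup A] [Finite A] where
  /-- The full subcategory `C_a`. -/
  comp : A → ObjectProperty C
  comp_iso {a : A} {X Y : C} : (X ≅ Y) → comp a X → comp a Y
  hom_eq_zero {a b : A} {X Y : C} : a ≠ b → comp a X → comp b Y → ∀ f : X ⟶ Y, f = 0
  decomposition (X : C) : ∃ Y : A → C, (∀ a, comp a (Y a)) ∧ Nonempty (X ≅ ⨁ Y)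
  comp_unit : comp 0 (𝟙_ C)
  comp_tensor {a b : A} {X Y : C} : comp a X → comp b Y → comp (a + b) (X ⊗ Y)

variable {C} {A : Type} [AddCommGroup A] [Finite A]

/-- The data `(λ, t, f)` of a ribbon zesting of an `A`-graded category (with trivial `j`), before any
condition is imposed. -/
structure ZestingData (𝒢 : Grading C A) where
  /-- The objects `λ(a,b)`. -/
  lam : A → A → C
  lam_mem (a b : A) : 𝒢.comp 0 (lam a b)
  lam_invertible (a b : A) : ∃ K : C, 𝒢.comp 0 K ∧ Nonempty (𝟙_ C ≅ K ⊗ lam a b)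
  /-- The isomorphisms `λ_{a,b,c}`. -/
  assoc (a b c : A) : lam a b ⊗ lam (a + b) c ≅ lam b c ⊗ lam a (b + c)
  /-- The normalization `λ(0,a) = 𝟙`. -/
  lamLeft (a : A) : lam 0 a ≅ 𝟙_ C
  /-- The normalization `λ(a,0) = 𝟙`. -/
  lamRight (a : A) : lam a 0 ≅ 𝟙_ C
  /-- The isomorphisms `t(a,b)`. -/
  t (a b : A) : lam a b ≅ lam b a
  /-- The function `f : A → kˣ`. -/
  f : A → kˣ

variable {k} {𝒢 : Grading C A}

/-- The identification of `λ(a,b)` with `λ(a',b')` when `a = a'` and `b = b'`. -/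
def ZestingData.cast (Z : ZestingData k 𝒢) {a a' b b' : A} (ha : a = a') (hb : b = b') :
    Z.lam a b ⟶ Z.lam a' b' :=
  eqToHom (by rw [ha, hb])

@[simp]
theorem ZestingData.cast_rfl (Z : ZestingData k 𝒢) (a b : A) :
    Z.cast (rfl : a = a) (rfl : b = b) = 𝟙 (Z.lam a b) := rfl

/-- The conditions that make zesting data (with trivial `j`) an `A`-ribbon zesting: the normalization
and the associative, braided, twist and ribbon zesting conditions. -/
structure ZestingData.IsRibbonZesting [BraidedCategory C] [BalancedCategory C]
    (Z : ZestingData k 𝒢) : Prop where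
  assoc_zero (a c : A) : (Z.assoc a 0 c).hom ≫
      ((Z.lamLeft c).hom ⊗ₘ Z.cast rfl (zero_add c)) =
    ((Z.lamRight a).hom ⊗ₘ Z.cast (add_zero a) rfl)
  /-- Associative zesting condition. -/
  assoc_condition (a b c d : A) :
    (Z.assoc a b c).hom ▷ Z.lam (a + b + c) d ≫
        (Z.lam b c ⊗ Z.lam a (b + c)) ◁ Z.cast (add_assoc a b c) rfl ≫
        (α_ _ _ _).hom ≫ Z.lam b c ◁ (Z.assoc a (b + c) d).hom ≫ (α_ _ _ _).inv ≫
        (Z.assoc b c d).hom ▷ Z.lam a (b + c + d) ≫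
        (Z.lam c d ⊗ Z.lam b (c + d)) ◁ Z.cast rfl (add_assoc b c d) =
      (α_ _ _ _).hom ≫ Z.lam a b ◁ (Z.assoc (a + b) c d).hom ≫ (α_ _ _ _).inv ≫
        (β_ (Z.lam c d) (Z.lam a b)).inv ▷ Z.lam (a + b) (c + d) ≫ (α_ _ _ _).hom ≫
        Z.lam c d ◁ (Z.assoc a b (c + d)).hom ≫ (α_ _ _ _).inv
  /-- First braided zesting condition. -/
  braid_condition₁ (a b c : A) :
    (Z.assoc a b c).hom ≫ Z.lam b c ◁ (Z.t a (b + c)).hom ≫ (Z.assoc b c a).hom =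
      ((Z.t a b).hom ⊗ₘ Z.cast (add_comm a b) rfl) ≫ (Z.assoc b a c).hom ≫
        ((Z.t a c).hom ⊗ₘ Z.cast rfl (add_comm a c))
  /-- Second braided zesting condition; the scalar `ω(a,b;c)` by which the double braiding with
  `λ(a,b)` acts on `C_c` is expressed by that double braiding. -/
  braid_condition₂ (a b c : A) (X : C) (hX : 𝒢.comp c X) :
    X ◁ (Z.assoc a b c).inv ≫ (α_ _ _ _).inv ≫
        ((β_ X (Z.lam a b)).hom ≫ (β_ (Z.lam a b) X).hom) ▷ Z.lam (a + b) c ≫ (α_ _ _ _).hom ≫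
        X ◁ (Z.lam a b ◁ (Z.t (a + b) c).hom ≫ (Z.assoc c a b).inv) =
      X ◁ (((Z.t b c).hom ⊗ₘ Z.cast rfl (add_comm b c)) ≫ (Z.assoc a c b).inv ≫
        ((Z.t a c).hom ⊗ₘ Z.cast (add_comm a c) rfl))
  /-- Twist zesting condition. -/
  twist_condition (a b : A) (X Y : C) (hX : 𝒢.comp a X) (hY : 𝒢.comp b Y) :
    (Z.f (a + b) : k) • ((β_ (X ⊗ Y) (Z.lam a b)).hom ≫ (β_ (Z.lam a b) (X ⊗ Y)).hom ≫
        (X ⊗ Y) ◁ (twist (Z.lam a b)).hom) =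
      ((Z.f a : k) * Z.f b) • ((X ⊗ Y) ◁ ((Z.t a b).hom ≫ (Z.t b a).hom))
  /-- Ribbon zesting condition. -/
  ribbon_condition (a : A) (X : C) (hX : 𝒢.comp a X) :
    (Z.f a : k) • 𝟙 (X ⊗ Z.lam a (-a)) =
      (Z.f (-a) : k) • ((β_ X (Z.lam a (-a))).hom ≫ (β_ (Z.lam a (-a)) X).hom ≫
        X ◁ (twist (Z.lam a (-a))).hom)

variable (k) in
/-- An `A`-ribbon zesting (with trivial `j`). -/
structure RibbonZesting [BraidedCategory C] [BalancedCategory C] (𝒢 : Grading C A) extends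
    ZestingData k 𝒢 where
  isRibbonZesting : toZestingData.IsRibbonZesting

variable [BraidedCategory C] [BalancedCategory C]

/-- The zested category, on homogeneous objects: a homogeneous object is an object of some `C_a`
together with the degree `a`. All the structure of the zested category is defined on homogeneous
objects (and extended additively to direct sums), and every simple object is homogeneous. -/
structure Zested (Z : RibbonZesting k 𝒢) where
  /-- The degree. -/
  deg : A
  /-- The underlying object of `C`. -/
  obj : C
  mem : 𝒢.comp deg obj

namespace Zested

variable {Z : RibbonZesting k 𝒢}

/-- A morphism of homogeneous objects: a morphism of `C` between objects of the same degree
(between objects of distinct degrees there are only zero morphisms, which are left out). -/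
@[ext]
structure Hom (X Y : Zested Z) where
  deg_eq : X.deg = Y.deg
  /-- The underlying morphism of `C`. -/
  hom : X.obj ⟶ Y.obj

instance : Category (Zested Z) where
  Hom := Hom
  id X := ⟨rfl, 𝟙 X.obj⟩
  comp f g := ⟨f.deg_eq.trans g.deg_eq, f.hom ≫ g.hom⟩
  id_comp _ := Hom.ext (Category.id_comp _)
  comp_id _ := Hom.ext (Category.comp_id _)
  assoc _ _ _ := Hom.ext (Category.assoc _ _ _)

@[ext]
theorem hom_ext {X Y : Zested Z} {f g : X ⟶ Y} (h : f.hom = g.hom) : f = g := Hom.ext h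

@[simp]
theorem id_hom (X : Zested Z) : (𝟙 X : X ⟶ X).hom = 𝟙 X.obj := rfl

@[simp]
theorem comp_hom {X Y W : Zested Z} (f : X ⟶ Y) (g : Y ⟶ W) : (f ≫ g).hom = f.hom ≫ g.hom := rfl

/-- An isomorphism of `C` between homogeneous objects of the same degree. -/
def mkIso {X Y : Zested Z} (h : X.deg = Y.deg) (e : X.obj ≅ Y.obj) : X ≅ Y where
  hom := ⟨h, e.hom⟩
  inv := ⟨h.symm, e.inv⟩
  hom_inv_id := hom_ext e.hom_inv_id
  inv_hom_id := hom_ext e.inv_hom_id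

@[simp]
theorem mkIso_hom_hom {X Y : Zested Z} (h : X.deg = Y.deg) (e : X.obj ≅ Y.obj) :
    (mkIso h e).hom.hom = e.hom := rfl

@[simp]
theorem mkIso_inv_hom {X Y : Zested Z} (h : X.deg = Y.deg) (e : X.obj ≅ Y.obj) :
    (mkIso h e).inv.hom = e.inv := rfl

/-- The zested monoidal structure: `X_a ⊗' Y_b = X_a ⊗ Y_b ⊗ λ(a,b)`, with the associator that
passes `λ(a,b)` under the third strand and then applies `λ_{a,b,c}`. -/
instance : MonoidalCategoryStruct (Zested Z) where
  tensorObj X Y := ⟨X.deg + Y.deg, (X.obj ⊗ Y.obj) ⊗ Z.lam X.deg Y.deg, by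
    have := 𝒢.comp_tensor (𝒢.comp_tensor X.mem Y.mem) (Z.lam_mem X.deg Y.deg)
    rwa [add_zero] at this⟩
  whiskerLeft X _ _ f := ⟨congrArg (X.deg + ·) f.deg_eq, (X.obj ◁ f.hom) ⊗ₘ Z.cast rfl f.deg_eq⟩
  whiskerRight f Y := ⟨congrArg (· + Y.deg) f.deg_eq, (f.hom ▷ Y.obj) ⊗ₘ Z.cast f.deg_eq rfl⟩
  tensorHom f g := ⟨congrArg₂ (· + ·) f.deg_eq g.deg_eq,
    (f.hom ⊗ₘ g.hom) ⊗ₘ Z.cast f.deg_eq g.deg_eq⟩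
  tensorUnit := ⟨0, 𝟙_ C, 𝒢.comp_unit⟩
  associator X Y W := mkIso (add_assoc X.deg Y.deg W.deg)
    (zAssocIso X.obj Y.obj W.obj (Z.assoc X.deg Y.deg W.deg))
  leftUnitor X := mkIso (zero_add X.deg) (((λ_ X.obj) ⊗ᵢ Z.lamLeft X.deg) ≪≫ ρ_ X.obj)
  rightUnitor X := mkIso (add_zero X.deg) (((ρ_ X.obj) ⊗ᵢ Z.lamRight X.deg) ≪≫ ρ_ X.obj)

theorem tensorHom_hom {X Y X' Y' : Zested Z} (f : X ⟶ X') (g : Y ⟶ Y') :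
    (f ⊗ₘ g).hom = (f.hom ⊗ₘ g.hom) ⊗ₘ Z.cast f.deg_eq g.deg_eq := rfl

theorem whiskerLeft_hom (X : Zested Z) {Y Y' : Zested Z} (g : Y ⟶ Y') :
    (X ◁ g).hom = (X.obj ◁ g.hom) ⊗ₘ Z.cast rfl g.deg_eq := rfl

theorem whiskerRight_hom {X X' : Zested Z} (f : X ⟶ X') (Y : Zested Z) :
    (f ▷ Y).hom = (f.hom ▷ Y.obj) ⊗ₘ Z.cast f.deg_eq rfl := rfl

theorem associator_hom_hom (X Y W : Zested Z) : (α_ X Y W).hom.hom =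
    zAssoc X.obj Y.obj W.obj (Z.assoc X.deg Y.deg W.deg).hom := rfl

theorem associator_inv_hom (X Y W : Zested Z) : (α_ X Y W).inv.hom =
    zAssocInv X.obj Y.obj W.obj (Z.assoc X.deg Y.deg W.deg).inv := rfl

theorem leftUnitor_hom_hom (X : Zested Z) : (λ_ X).hom.hom =
    ((λ_ X.obj).hom ⊗ₘ (Z.lamLeft X.deg).hom) ≫ (ρ_ X.obj).hom := rfl

theorem rightUnitor_hom_hom (X : Zested Z) : (ρ_ X).hom.hom =
    ((ρ_ X.obj).hom ⊗ₘ (Z.lamRight X.deg).hom) ≫ (ρ_ X.obj).hom := rfl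

theorem cast_comp_cast (Z : ZestingData k 𝒢) {a a' a'' b b' b'' : A} (h₁ : a = a') (h₂ : b = b')
    (h₃ : a' = a'') (h₄ : b' = b'') :
    Z.cast h₁ h₂ ≫ Z.cast h₃ h₄ = Z.cast (h₁.trans h₃) (h₂.trans h₄) := by
  simp [ZestingData.cast]

instance : MonoidalCategory (Zested Z) where
  tensorHom_def f g := by
    ext
    rw [comp_hom, tensorHom_hom, whiskerLeft_hom, whiskerRight_hom, tensorHom_comp_tensorHom,
      cast_comp_cast, MonoidalCategory.tensorHom_def f.hom g.hom]
  id_tensorHom_id X Y := by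
    ext
    rw [tensorHom_hom]
    simp
    rfl
  tensorHom_comp_tensorHom f₁ f₂ g₁ g₂ := by
    ext
    rw [comp_hom, tensorHom_hom, tensorHom_hom, tensorHom_hom, tensorHom_comp_tensorHom,
      cast_comp_cast, tensorHom_comp_tensorHom]
    rfl
  whiskerLeft_id X Y := by
    ext
    rw [whiskerLeft_hom]
    simp
    rfl
  id_whiskerRight X Y := by
    ext
    rw [whiskerRight_hom]
    simp
    rfl
  associator_naturality {X₁ X₂ X₃ Y₁ Y₂ Y₃} f₁ f₂ f₃ := by
    rcases X₁ with ⟨a₁, X₁, _⟩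
    rcases X₂ with ⟨a₂, X₂, _⟩
    rcases X₃ with ⟨a₃, X₃, _⟩
    rcases Y₁ with ⟨b₁, Y₁, _⟩
    rcases Y₂ with ⟨b₂, Y₂, _⟩
    rcases Y₃ with ⟨b₃, Y₃, _⟩
    rcases f₁ with ⟨h₁, f₁⟩
    rcases f₂ with ⟨h₂, f₂⟩
    rcases f₃ with ⟨h₃, f₃⟩
    dsimp only at h₁ h₂ h₃ f₁ f₂ f₃
    subst h₁ h₂ h₃
    ext
    exact zAssoc_naturality f₁ f₂ f₃ _
  leftUnitor_naturality {X Y} f := by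
    rcases X with ⟨a, X, _⟩
    rcases Y with ⟨b, Y, _⟩
    rcases f with ⟨h, f⟩
    dsimp only at h f
    subst h
    ext
    change ((𝟙_ C ◁ f) ⊗ₘ 𝟙 _) ≫ ((λ_ Y).hom ⊗ₘ (Z.lamLeft a).hom) ≫ (ρ_ Y).hom =
      (((λ_ X).hom ⊗ₘ (Z.lamLeft a).hom) ≫ (ρ_ X).hom) ≫ f
    rw [tensorHom_comp_tensorHom_assoc, leftUnitor_naturality, Category.id_comp, Category.assoc,
      ← rightUnitor_naturality, ← tensorHom_id, tensorHom_comp_tensorHom_assoc, Category.comp_id]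
  rightUnitor_naturality {X Y} f := by
    rcases X with ⟨a, X, _⟩
    rcases Y with ⟨b, Y, _⟩
    rcases f with ⟨h, f⟩
    dsimp only at h f
    subst h
    ext
    change ((f ▷ 𝟙_ C) ⊗ₘ 𝟙 _) ≫ ((ρ_ Y).hom ⊗ₘ (Z.lamRight a).hom) ≫ (ρ_ Y).hom =
      (((ρ_ X).hom ⊗ₘ (Z.lamRight a).hom) ≫ (ρ_ X).hom) ≫ f
    rw [tensorHom_comp_tensorHom_assoc, rightUnitor_naturality, Category.id_comp, Category.assoc,
      ← rightUnitor_naturality f, ← tensorHom_id f (𝟙_ C), tensorHom_comp_tensorHom_assoc,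
      Category.comp_id, tensorHom_id, rightUnitor_naturality]
  pentagon X Y W V := by
    ext
    exact zAssoc_pentagon X.obj Y.obj W.obj V.obj _ _ _ _ _ _ _
      (Z.isRibbonZesting.assoc_condition X.deg Y.deg W.deg V.deg)
  triangle X Y := by
    ext
    exact zAssoc_triangle X.obj Y.obj _ _ _ _ _ (Z.isRibbonZesting.assoc_zero X.deg Y.deg)

/-- The zested braiding `c'_{X_a,Y_b} = c_{X_a,Y_b} ⊗ t(a,b)`. -/
instance : BraidedCategory (Zested Z) where
  braiding X Y := mkIso (add_comm X.deg Y.deg) (β_ X.obj Y.obj ⊗ᵢ Z.t X.deg Y.deg)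
  braiding_naturality_right X {Y W} f := by
    rcases Y with ⟨a, Y, _⟩
    rcases W with ⟨b, W, _⟩
    rcases f with ⟨h, f⟩
    dsimp only at h f
    subst h
    ext
    change ((X.obj ◁ f) ⊗ₘ 𝟙 _) ≫ ((β_ X.obj W).hom ⊗ₘ (Z.t X.deg a).hom) =
      ((β_ X.obj Y).hom ⊗ₘ (Z.t X.deg a).hom) ≫ ((f ▷ X.obj) ⊗ₘ 𝟙 _)
    rw [tensorHom_comp_tensorHom, tensorHom_comp_tensorHom,
      BraidedCategory.braiding_naturality_right, Category.id_comp, Category.comp_id]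
  braiding_naturality_left {X Y} f W := by
    rcases X with ⟨a, X, _⟩
    rcases Y with ⟨b, Y, _⟩
    rcases f with ⟨h, f⟩
    dsimp only at h f
    subst h
    ext
    change ((f ▷ W.obj) ⊗ₘ 𝟙 _) ≫ ((β_ Y W.obj).hom ⊗ₘ (Z.t a W.deg).hom) =
      ((β_ X W.obj).hom ⊗ₘ (Z.t a W.deg).hom) ≫ ((W.obj ◁ f) ⊗ₘ 𝟙 _)
    rw [tensorHom_comp_tensorHom, tensorHom_comp_tensorHom,
      BraidedCategory.braiding_naturality_left, Category.id_comp, Category.comp_id]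
  hexagon_forward X Y W := by
    ext
    exact zBraid_hexagon_forward X.obj Y.obj W.obj _ _ _ _ _ _ _ _
      (Z.isRibbonZesting.braid_condition₁ X.deg Y.deg W.deg)
  hexagon_reverse X Y W := by
    ext
    exact zBraid_hexagon_reverse X.obj Y.obj W.obj _ _ _ _ _ _ _ _
      (Z.isRibbonZesting.braid_condition₂ X.deg Y.deg W.deg W.obj W.mem)

variable [MonoidalPreadditive C] [MonoidalLinear k C]

/-- The zested twist `θ'_{X_a} = f(a) θ_{X_a}`. -/
instance : BalancedCategory (Zested Z) where
  twist X := mkIso rfl (unitSmul (Z.f X.deg) (twist X.obj))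
  twist_naturality {X Y} f := by
    rcases X with ⟨a, X, _⟩
    rcases Y with ⟨b, Y, _⟩
    rcases f with ⟨h, f⟩
    dsimp only at h f
    subst h
    ext
    change f ≫ ((Z.f a : k) • (twist Y).hom) = ((Z.f a : k) • (twist X).hom) ≫ f
    rw [Linear.comp_smul, Linear.smul_comp, BalancedCategory.twist_naturality]
  twist_tensor X Y := by
    rcases X with ⟨a, X, hX⟩
    rcases Y with ⟨b, Y, hY⟩
    ext
    change (Z.f (a + b) : k) • (twist ((X ⊗ Y) ⊗ Z.lam a b)).hom =
      ((β_ X Y).hom ⊗ₘ (Z.t a b).hom) ≫ ((β_ Y X).hom ⊗ₘ (Z.t b a).hom) ≫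
        ((((Z.f a : k) • (twist X).hom) ⊗ₘ ((Z.f b : k) • (twist Y).hom)) ⊗ₘ 𝟙 _)
    have e := Z.isRibbonZesting.twist_condition a b X Y hX hY
    calc (Z.f (a + b) : k) • (twist ((X ⊗ Y) ⊗ Z.lam a b)).hom =
        ((Z.f (a + b) : k) • ((β_ (X ⊗ Y) (Z.lam a b)).hom ≫ (β_ (Z.lam a b) (X ⊗ Y)).hom ≫
          (X ⊗ Y) ◁ (twist (Z.lam a b)).hom)) ≫ (twist (X ⊗ Y)).hom ▷ Z.lam a b := by
          rw [BalancedCategory.twist_tensor, MonoidalCategory.tensorHom_def', Linear.smul_comp]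
          simp only [Category.assoc]
      _ = _ := by
          rw [e, BalancedCategory.twist_tensor]
          simp only [MonoidalCategory.tensorHom_def, MonoidalLinear.smul_whiskerRight,
            MonoidalLinear.whiskerLeft_smul, Linear.smul_comp, Linear.comp_smul, smul_smul]
          rw [mul_comm (Z.f b : k)]
          congr 1
          rw [whiskerLeft_comp, Category.assoc, whisker_exchange, whisker_exchange_assoc]
          simp only [comp_whiskerRight, Category.assoc, whiskerLeft_id, Category.comp_id,
            whisker_exchange_assoc, whisker_exchange]

end Zested

/-- The dual of an object of degree `a` has degree `-a`. -/
theorem Grading.comp_rightDual [RightRigidCategory C] {a : A} {X : C} (h : 𝒢.comp a X) :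
    𝒢.comp (-a) (Xᘁ) := by
  obtain ⟨Y, hY, ⟨e⟩⟩ := 𝒢.decomposition (Xᘁ)
  have h0 : ∀ b, b ≠ -a → ∀ f : Y b ⟶ Xᘁ, f = 0 := by
    intro b hb f
    have hb' : b + a ≠ 0 := fun h' => hb (eq_neg_of_add_eq_zero_left h')
    have h1 : ∀ u v : Y b ⊗ X ⟶ 𝟙_ C, u = v := fun u v =>
      (𝒢.hom_eq_zero hb' (𝒢.comp_tensor (hY b) h) 𝒢.comp_unit u).trans
        (𝒢.hom_eq_zero hb' (𝒢.comp_tensor (hY b) h) 𝒢.comp_unit v).symm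
    have h2 := (tensorRightHomEquiv (Y b) X (Xᘁ) (𝟙_ C)).symm.injective
      (h1 ((tensorRightHomEquiv (Y b) X (Xᘁ) (𝟙_ C)).symm (f ≫ (λ_ _).inv))
        ((tensorRightHomEquiv (Y b) X (Xᘁ) (𝟙_ C)).symm (0 ≫ (λ_ _).inv)))
    exact (cancel_mono _).1 h2
  have h3 : ∀ b, b ≠ -a → Limits.biproduct.ι Y b = 0 := by
    intro b hb
    have := h0 b hb (Limits.biproduct.ι Y b ≫ e.inv)
    rwa [← Limits.zero_comp (f := e.inv), cancel_mono] at this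
  classical
  refine 𝒢.comp_iso (?_ : Y (-a) ≅ Xᘁ) (hY _)
  refine ⟨Limits.biproduct.ι Y (-a), Limits.biproduct.π Y (-a), by simp, ?_⟩ ≪≫ e.symm
  apply Limits.biproduct.hom_ext'
  intro b
  by_cases hb : b = -a
  · subst hb; simp
  · rw [h3 b hb, Limits.zero_comp, Limits.zero_comp]

namespace Zested

variable {Z : RibbonZesting k 𝒢} [RightRigidCategory C]

/-- The inverse of `λ(a,-a)`. -/
def lamInv (Z : ZestingData k 𝒢) (a : A) : C := (Z.lam_invertible a (-a)).choose

theorem lamInv_mem (Z : ZestingData k 𝒢) (a : A) : 𝒢.comp 0 (lamInv Z a) :=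
  (Z.lam_invertible a (-a)).choose_spec.1

/-- The isomorphism that exhibits `lamInv Z a` as the inverse of `λ(a,-a)`. -/
def lamInvIso (Z : ZestingData k 𝒢) (a : A) : 𝟙_ C ≅ lamInv Z a ⊗ Z.lam a (-a) :=
  (Z.lam_invertible a (-a)).choose_spec.2.some

/-- The zested dual of `X_a` is `X^* ⊗ λ(a,-a)⁻¹`. -/
def dual (X : Zested Z) : Zested Z where
  deg := -X.deg
  obj := (X.obj)ᘁ ⊗ lamInv Z.toZestingData X.deg
  mem := by
    have := 𝒢.comp_tensor (𝒢.comp_rightDual X.mem) (lamInv_mem Z.toZestingData X.deg)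
    rwa [add_zero] at this

/-- The isomorphism between `λ(a,-a)⁻¹ ⊗ λ(-a,a)` and the unit used in the zested evaluation. -/
def dualMu (Z : ZestingData k 𝒢) (a : A) : lamInv Z a ⊗ Z.lam (-a) a ≅ 𝟙_ C :=
  zMu (lamInvIso Z a) (Z.assoc a (-a) a)
    (eqToIso (by rw [add_neg_cancel]) ≪≫ Z.lamLeft a)
    (eqToIso (by rw [neg_add_cancel]) ≪≫ Z.lamRight a)

/-- The zested coevaluation. -/
def coev (X : Zested Z) : 𝟙_ (Zested Z) ⟶ X ⊗ dual X where
  deg_eq := (add_neg_cancel X.deg).symm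
  hom := zCoev (η_ X.obj (X.obj)ᘁ) (lamInvIso Z.toZestingData X.deg).hom

/-- The zested evaluation. -/
def ev (X : Zested Z) : dual X ⊗ X ⟶ 𝟙_ (Zested Z) where
  deg_eq := neg_add_cancel X.deg
  hom := zEv (ε_ X.obj (X.obj)ᘁ) (dualMu Z.toZestingData X.deg).hom

theorem coev_ev (X : Zested Z) :
    coev X ▷ X ≫ (α_ X (dual X) X).hom ≫ X ◁ ev X = (λ_ X).hom ≫ (ρ_ X).inv := by
  rw [← cancel_mono (ρ_ X).hom, Category.assoc, Category.assoc, Category.assoc, Iso.inv_hom_id,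
    Category.comp_id]
  have := z_zigzag₁ (P₀ := Z.lam 0 X.deg) (R₀ := Z.lam X.deg 0) (η_ X.obj (X.obj)ᘁ)
    (ε_ X.obj (X.obj)ᘁ)
    (ExactPairing.evaluation_coevaluation _ _) (lamInvIso Z.toZestingData X.deg).hom
    (dualMu Z.toZestingData X.deg).hom (Z.assoc X.deg (-X.deg) X.deg).hom
    (Z.cast (add_neg_cancel X.deg).symm rfl) (Z.cast rfl (neg_add_cancel X.deg))
    (Z.lamLeft X.deg).hom (Z.lamRight X.deg).hom (by
      have e := zMu_spec (lamInvIso Z.toZestingData X.deg) (Z.assoc X.deg (-X.deg) X.deg)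
        (eqToIso (by rw [add_neg_cancel]) ≪≫ Z.lamLeft X.deg)
        (eqToIso (by rw [neg_add_cancel]) ≪≫ Z.lamRight X.deg)
      simp only [Iso.trans_hom, eqToIso.hom] at e
      rw [dualMu]
      simp only [ZestingData.cast]
      rw [e]
      simp)
  ext
  simp only [Category.assoc] at this
  exact this

theorem isIso_of_hom {X Y : Zested Z} (f : X ⟶ Y) (h : IsIso f.hom) : IsIso f :=
  (mkIso f.deg_eq (asIso f.hom)).isIso_hom

theorem isIso_ev_coev (X : Zested Z) :
    IsIso (dual X ◁ coev X ≫ (α_ (dual X) X (dual X)).inv ≫ ev X ▷ dual X) := by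
  apply isIso_of_hom
  exact z_zigzag₂_isIso (η_ X.obj (X.obj)ᘁ) (ε_ X.obj (X.obj)ᘁ)
    (ExactPairing.coevaluation_evaluation _ _) (lamInvIso Z.toZestingData X.deg)
    (dualMu Z.toZestingData X.deg) (Z.assoc (-X.deg) X.deg (-X.deg)).symm
    (eqToIso (by rw [add_neg_cancel]; rfl)) (eqToIso (by rw [neg_add_cancel]; rfl))

instance : RightRigidCategory (Zested Z) where
  rightDual X :=
    { rightDual := dual X
      exact := exactPairingOfIsIso (coev X) (ev X) (coev_ev X) (isIso_ev_coev X) }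

end Zested

end Zesting

/-! ## Cyclic ribbon zestings -/

section Cyclic

variable {C : Type u} [Category.{v} C] [MonoidalCategory C]

/-- The tensor power `g^n`. -/
def tensorPow (g : C) : ℕ → C
  | 0 => 𝟙_ C
  | n + 1 => tensorPow g n ⊗ g

/-- The canonical isomorphism `g^m ⊗ g^n ≅ g^(m+n)`. -/
def tensorPowAdd (g : C) (m : ℕ) : ∀ n, tensorPow g m ⊗ tensorPow g n ≅ tensorPow g (m + n)
  | 0 => ρ_ (tensorPow g m)
  | n + 1 => (α_ (tensorPow g m) (tensorPow g n) g).symm ≪≫ whiskerRightIso (tensorPowAdd g m n) g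

/-- The canonical isomorphism `g^m ⊗ g^n ≅ g^m' ⊗ g^n'` when `m + n = m' + n'`. -/
def tensorPowIso (g : C) {m n m' n' : ℕ} (h : m + n = m' + n') :
    tensorPow g m ⊗ tensorPow g n ≅ tensorPow g m' ⊗ tensorPow g n' :=
  tensorPowAdd g m n ≪≫ eqToIso (by rw [h]) ≪≫ (tensorPowAdd g m' n').symm

variable {N : ℕ} [NeZero N]

/-- The exponent of `g` in `λ_a(i,j)`: it is `0` if `i + j < N` and `a` if `i + j ≥ N`, for the
representatives `0 ≤ i, j, a < N`. -/
def zestingExponent (a i j : ZMod N) : ℕ :=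
  if i.val + j.val < N then 0 else a.val

theorem zestingExponent_comm (a i j : ZMod N) : zestingExponent a i j = zestingExponent a j i := by
  rw [zestingExponent, zestingExponent, Nat.add_comm]

theorem zestingExponent_zero_left (a i : ZMod N) : zestingExponent a 0 i = 0 := by
  have := ZMod.val_lt i
  simp [zestingExponent, ZMod.val_zero, this]

theorem zestingExponent_zero_right (a i : ZMod N) : zestingExponent a i 0 = 0 := by
  rw [zestingExponent_comm, zestingExponent_zero_left]

theorem zestingExponent_assoc (a i j l : ZMod N) :
    zestingExponent a i j + zestingExponent a (i + j) l =
      zestingExponent a j l + zestingExponent a i (j + l) := by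
  have key (x y : ZMod N) : (x + y).val = if x.val + y.val < N then x.val + y.val else
      x.val + y.val - N := by
    split_ifs with h
    · exact ZMod.val_add_of_lt h
    · exact ZMod.val_add_of_le (not_lt.1 h)
  have hi := ZMod.val_lt i
  have hj := ZMod.val_lt j
  have hl := ZMod.val_lt l
  simp only [zestingExponent, key]
  split_ifs <;> omega

variable (k : Type w) [Field k] [Abelian C] [Linear k C] [BraidedCategory C] [BalancedCategory C]
  [RightRigidCategory C]

open Classical in
/-- `ε(a)` is `1` if `θ_{g^a} = -1` and `0` otherwise. -/
def epsilon (g : C) (a : ZMod N) : ℕ :=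
  if (twist (tensorPow g a.val)).hom = -𝟙 _ then 1 else 0

/-- The parameters of a cyclic zesting of a `ℤ/N`-graded category: a generator `g` of a symmetric
subcategory of the trivial component with the fusion rules of `Rep(ℤ/N)` and positive dimensions, a
`2N`-th root of unity `ζ`, and a triple `(a,b,s)` such that `a = ε(a) + 2b` modulo `N` and
`s^N = ζ^(-(ε(a)+2b))`. -/
structure CyclicZestingData (𝒢 : Grading C (ZMod N)) where
  /-- The generator of `Rep(ℤ/N)`. -/
  g : C
  g_mem : 𝒢.comp 0 g
  g_order (n : ℕ) : Nonempty (tensorPow g n ≅ 𝟙_ C) ↔ N ∣ n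
  g_symmetric : (β_ g g).hom ≫ (β_ g g).hom = 𝟙 (g ⊗ g)
  g_dim : trace (𝟙 g) = 𝟙 (𝟙_ C)
  /-- The root of unity `ζ`. -/
  ζ : kˣ
  ζ_pow : ζ ^ (2 * N) = 1
  /-- The parameter `a`. -/
  a : ZMod N
  /-- The parameter `b`. -/
  b : ZMod N
  /-- The parameter `s`. -/
  s : kˣ
  a_eq : a = epsilon g a + 2 * b
  s_pow : s ^ N = (ζ ^ (epsilon g a + 2 * b.val))⁻¹

namespace CyclicZestingData

variable {k} {𝒢 : Grading C (ZMod N)}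

theorem tensorPow_mem (D : CyclicZestingData k 𝒢) (n : ℕ) : 𝒢.comp 0 (tensorPow D.g n) := by
  induction n with
  | zero => exact 𝒢.comp_unit
  | succ n ih =>
    have := 𝒢.comp_tensor ih D.g_mem
    rwa [add_zero] at this

/-- The scalars `λ_b(i,j,l)`. -/
def scalar (D : CyclicZestingData k 𝒢) (i j l : ZMod N) : kˣ :=
  if i.val + j.val < N then 1 else D.ζ ^ (l.val * (epsilon D.g D.a + 2 * D.b.val))

/-- The data `(λ_a, λ_b, t_s, f_s)`. -/
def zestingData (D : CyclicZestingData k 𝒢) : ZestingData k 𝒢 where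
  lam i j := tensorPow D.g (zestingExponent D.a i j)
  lam_mem i j := D.tensorPow_mem _
  lam_invertible i j := by
    set n := zestingExponent D.a i j
    obtain ⟨e⟩ := (D.g_order (n * (N - 1) + n)).2 ⟨n, by
      obtain ⟨M, hM⟩ := Nat.exists_eq_succ_of_ne_zero (NeZero.ne N)
      rw [hM, Nat.succ_sub_one, Nat.succ_eq_add_one]
      ring⟩
    exact ⟨tensorPow D.g (n * (N - 1)), D.tensorPow_mem _,
      ⟨e.symm ≪≫ (tensorPowAdd D.g (n * (N - 1)) n).symm⟩⟩
  assoc i j l := unitSmul (D.scalar i j l) (tensorPowIso D.g (zestingExponent_assoc D.a i j l))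
  lamLeft i := eqToIso (by rw [zestingExponent_zero_left, tensorPow])
  lamRight i := eqToIso (by rw [zestingExponent_zero_right, tensorPow])
  t i j := unitSmul (D.s⁻¹ ^ (i.val * j.val)) (eqToIso (by rw [zestingExponent_comm]))
  f i := D.s⁻¹ ^ (i.val ^ 2)

end CyclicZestingData

/-- A cyclic ribbon zesting `(λ_a, λ_b, t_s, f_s)` of a `ℤ/N`-graded category: a ribbon zesting
whose data have the cyclic form. -/
structure CyclicRibbonZesting (𝒢 : Grading C (ZMod N)) extends CyclicZestingData k 𝒢 where
  isRibbonZesting : toCyclicZestingData.zestingData.IsRibbonZesting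

variable {k} in
/-- The underlying ribbon zesting of a cyclic ribbon zesting. -/
def CyclicRibbonZesting.ribbonZesting {𝒢 : Grading C (ZMod N)}
    (D : CyclicRibbonZesting k 𝒢) : RibbonZesting k 𝒢 where
  toZestingData := D.zestingData
  isRibbonZesting := D.isRibbonZesting

variable {k} in
/-- An object of `C_i`, regarded as a homogeneous object of degree `i` of the zested category. -/
def CyclicRibbonZesting.zest {𝒢 : Grading C (ZMod N)} (D : CyclicRibbonZesting k 𝒢)
    {i : ZMod N} {X : C} (hX : 𝒢.comp i X) : Zested D.ribbonZesting :=
  ⟨i, X, hX⟩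

end Cyclic

end

end ZestedLinks

/-! Zesting multiplies each braid generator by a scalar, and the three links are such that these
scalars combine into a power of `s`. In a zested triple product $(X_i\otimes' Y_j)\otimes' V_l$ the
factors $\lambda_a$ are powers of $g$. Moving them to the right end, with the same crossings that
the zested associator uses, and fusing them into one power $g^n$ is an isomorphism `norm`.
Conjugated by it, $\sigma_1$ becomes $s^{-ij}$ times $\sigma_1$ of $\mathcal C$, tensored with the
identity of $g^n$. For $\sigma_2$, which is conjugated by associators, the factor is
$\lambda_b(i,j,l)\,\lambda_b(i,l,j)^{-1}s^{-jl}$ (`normalizes_sigma₁`, `normalizes_sigma₂`). The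
exponent $n$ is $a$ times the number of carries in $i+j+l$, so it does not change along the braid.
The factors multiply under composition.

Two facts remove the zesting from the trace. By `zested_trace_hom`, the zested trace of an
endomorphism is the trace in $\mathcal C$ of the underlying morphism: besides that trace there
remain $f_s(i)$, $t_s(i,-i)$ and a loop equal to $\lambda_b(i,-i,i)^{-1}$, and their product is $1$
because $s^N=\zeta^{-(\epsilon(a)+2b)}$. By `trace_whiskerRight_tensorPow`, tensoring with the
identity of $g^n$ does not change a trace, because $\dim g=1$.

It remains to multiply scalars. The $\lambda_b$-factors cancel in each of the three braids. The
powers of $s$ count signed crossings: in the Whitehead braid those between different components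
cancel, leaving one self-crossing and the factor from $\theta_Y^{-1}$; in the Borromean braid each
pair of strands crosses with both signs; the braid of $5_2$ has writhe $-4$. -/

namespace ZestedLinks

open BalancedCategory (twist twist_naturality twist_tensor)

noncomputable section

set_option linter.unusedSectionVars false

/-! ### The quantum trace: cyclicity and tensoring with an object of dimension one. -/

section Trace

variable {C : Type u} [Category.{v} C] [MonoidalCategory C] [BraidedCategory C]
  [BalancedCategory C]

/-- The morphism `f` slides around the closed strand: through the coevaluation as its mate, across
the braiding, back through the evaluation, and past the twist, each time by naturality. -/
theorem trace_comm {X Y : C} [HasRightDual X] [HasRightDual Y] (f : X ⟶ Y) (g : Y ⟶ X) :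
    trace (f ≫ g) = trace (g ≫ f) := by
  calc trace (f ≫ g) =
      (η_ X (Xᘁ) ≫ f ▷ Xᘁ) ≫ (g ≫ (twist X).hom) ▷ Xᘁ ≫ (β_ X (Xᘁ)).hom ≫ ε_ X (Xᘁ) := by
        simp only [trace, comp_whiskerRight, Category.assoc]
    _ = η_ Y (Yᘁ) ≫ (g ≫ (twist X).hom) ▷ Yᘁ ≫ (β_ X (Yᘁ)).hom ≫ (fᘁ ▷ X ≫ ε_ X (Xᘁ)) := by
        rw [← coevaluation_comp_rightAdjointMate, Category.assoc, whisker_exchange_assoc,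
          BraidedCategory.braiding_naturality_right_assoc]
    _ = trace (g ≫ f) := by
        rw [rightAdjointMate_comp_evaluation, ← BraidedCategory.braiding_naturality_left_assoc,
          ← comp_whiskerRight_assoc, Category.assoc, ← twist_naturality, trace, Category.assoc]

theorem trace_conj {X Y : C} [HasRightDual X] [HasRightDual Y] (e : X ≅ Y) (f : Y ⟶ Y) :
    trace (e.hom ≫ f ≫ e.inv) = trace f := by
  rw [trace_comm, Category.assoc, e.inv_hom_id, Category.comp_id]

/-- A strand that closes up around a strand `X` can be pulled off `X`. -/
theorem braiding_whiskerRight_evaluation (X G D : C) (ε : D ⊗ G ⟶ 𝟙_ C) :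
    (β_ X (G ⊗ D)).hom ≫ ((β_ G D).hom ≫ ε) ▷ X =
      X ◁ ((β_ G D).hom ≫ ε) ≫ (ρ_ X).hom ≫ (λ_ X).inv := by
  rw [← BraidedCategory.braiding_naturality_right, braiding_tensorUnit_right]

/-- The evaluation on a tensor product, closed up after the double braiding of the factors. -/
theorem monodromy_braiding_evaluation (X G D E : C) (ε : D ⊗ G ⟶ 𝟙_ C) (ε' : E ⊗ X ⟶ 𝟙_ C) :
    ((β_ X G).hom ≫ (β_ G X).hom) ▷ (D ⊗ E) ≫ (β_ (X ⊗ G) (D ⊗ E)).hom ⊗≫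
        D ◁ (ε' ▷ G) ⊗≫ ε =
      𝟙 _ ⊗≫ X ◁ ((β_ G D).hom ≫ ε) ▷ E ⊗≫ (β_ X E).hom ≫ ε' := by
  -- The strand `G` can be pulled off the whole closed pair `X ⊗ E`, so crossing only `E` amounts to
  -- undoing the crossing with `X`.
  have h1 : X ◁ (β_ G E).hom ⊗≫ ((β_ X E).hom ≫ ε') ▷ G =
      (𝟙 _ ⊗≫ (β_ G X).inv ▷ E ⊗≫ G ◁ ((β_ X E).hom ≫ ε') ⊗≫ 𝟙 _ : X ⊗ G ⊗ E ⟶ 𝟙_ C ⊗ G) := by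
    have h2 : (β_ G (X ⊗ E)).hom ≫ ((β_ X E).hom ≫ ε') ▷ G =
      G ◁ ((β_ X E).hom ≫ ε') ≫ (ρ_ G).hom ≫ (λ_ G).inv := by
      rw [← BraidedCategory.braiding_naturality_right, braiding_tensorUnit_right]
    calc X ◁ (β_ G E).hom ⊗≫ ((β_ X E).hom ≫ ε') ▷ G =
        𝟙 _ ⊗≫ ((β_ G X).inv ≫ (β_ G X).hom) ▷ E ⊗≫ X ◁ (β_ G E).hom ⊗≫
          ((β_ X E).hom ≫ ε') ▷ G := by
          rw [Iso.inv_hom_id]; monoidal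
      _ = 𝟙 _ ⊗≫ (β_ G X).inv ▷ E ⊗≫ ((β_ G (X ⊗ E)).hom ≫ ((β_ X E).hom ≫ ε') ▷ G) := by
          rw [BraidedCategory.braiding_tensor_right_hom]; monoidal
      _ = _ := by rw [h2]; monoidal
  calc ((β_ X G).hom ≫ (β_ G X).hom) ▷ (D ⊗ E) ≫ (β_ (X ⊗ G) (D ⊗ E)).hom ⊗≫
        D ◁ (ε' ▷ G) ⊗≫ ε =
      𝟙 _ ⊗≫ (((β_ X G).hom ≫ (β_ G X).hom) ▷ D ⊗≫ X ◁ (β_ G D).hom ⊗≫ (β_ X D).hom ▷ G) ▷ E ⊗≫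
        D ◁ (X ◁ (β_ G E).hom ⊗≫ ((β_ X E).hom ≫ ε') ▷ G) ⊗≫ ε := by
        rw [BraidedCategory.braiding_tensor_right_hom, BraidedCategory.braiding_tensor_left_hom,
          BraidedCategory.braiding_tensor_left_hom]
        monoidal
    _ = 𝟙 _ ⊗≫ (β_ X G).hom ▷ D ▷ E ⊗≫ ((β_ G X).hom ▷ D ⊗≫ X ◁ (β_ G D).hom ⊗≫
          (β_ X D).hom ▷ G) ▷ E ⊗≫
        D ◁ ((β_ G X).inv ▷ E) ⊗≫ ((D ⊗ G) ◁ ((β_ X E).hom ≫ ε') ≫ ε ▷ 𝟙_ C) ⊗≫ 𝟙 _ := by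
        rw [h1]; monoidal
    -- Yang–Baxter moves the crossing of `G` with `X` next to the inverse crossing produced by `h1`.
    -- Once they cancel, `X` merely passes the closed pair `G ⊗ D`.
    _ = 𝟙 _ ⊗≫ (β_ X G).hom ▷ D ▷ E ⊗≫ (G ◁ (β_ X D).hom ⊗≫ (β_ G D).hom ▷ X) ▷ E ⊗≫
        D ◁ (((β_ G X).hom ≫ (β_ G X).inv) ▷ E) ⊗≫
        (ε ▷ (X ⊗ E) ≫ 𝟙_ C ◁ ((β_ X E).hom ≫ ε')) ⊗≫ 𝟙 _ := by
        rw [← whisker_exchange, BraidedCategory.yang_baxter']; monoidal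
    _ = 𝟙 _ ⊗≫ ((β_ X (G ⊗ D)).hom ≫ ((β_ G D).hom ≫ ε) ▷ X) ▷ E ⊗≫
        ((β_ X E).hom ≫ ε') ⊗≫ 𝟙 _ := by
        rw [Iso.hom_inv_id, BraidedCategory.braiding_tensor_right_hom]; monoidal
    _ = _ := by
        rw [braiding_whiskerRight_evaluation]; monoidal

/-- No transparency of `G` is needed: the twist of `X ⊗ G` contains the double braiding of the
factors, and this is what unlinks the two loops in `monodromy_braiding_evaluation`. The loop of `G`
is then the scalar `trace (𝟙 G)`. -/
theorem trace_whiskerRight {X G : C} [HasRightDual X] [HasRightDual G] [inst : HasRightDual (X ⊗ G)]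
    (h : X ⟶ X) (hG : trace (𝟙 G) = 𝟙 (𝟙_ C)) : trace (h ▷ G) = trace h := by
  -- Cyclicity with the identity, taken for two different duals of `X ⊗ G`, shows that the trace
  -- does not depend on the dual. The dual `Gᘁ ⊗ Xᘁ` has explicit evaluation and coevaluation.
  have e := @trace_comm C _ _ _ _ (X ⊗ G) (X ⊗ G) inst hasRightDualTensor (h ▷ G) (𝟙 _)
  rw [Category.comp_id, Category.id_comp] at e
  rw [e]
  have e2 : @trace C _ _ _ _ (X ⊗ G) hasRightDualTensor (h ▷ G) =
      η_ X Xᘁ ⊗≫ X ◁ (η_ G Gᘁ) ▷ Xᘁ ⊗≫ (h ▷ G ≫ (twist (X ⊗ G)).hom) ▷ (Gᘁ ⊗ Xᘁ) ≫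
        (β_ (X ⊗ G) (Gᘁ ⊗ Xᘁ)).hom ⊗≫ Gᘁ ◁ (ε_ X Xᘁ ▷ G) ⊗≫ ε_ G Gᘁ := by
    change ExactPairing.coevaluation (X ⊗ G) (Gᘁ ⊗ Xᘁ) ≫ _ ≫ _ ≫
      ExactPairing.evaluation (X ⊗ G) (Gᘁ ⊗ Xᘁ) = _
    rw [ExactPairing.tensor_coevaluation, ExactPairing.tensor_evaluation]
    monoidal
  rw [e2]
  calc _ = η_ X Xᘁ ⊗≫ X ◁ (η_ G Gᘁ) ▷ Xᘁ ⊗≫ (h ▷ G ≫ ((twist X).hom ⊗ₘ (twist G).hom)) ▷ (Gᘁ ⊗ Xᘁ) ≫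
        (((β_ X G).hom ≫ (β_ G X).hom) ▷ (Gᘁ ⊗ Xᘁ) ≫
        (β_ (X ⊗ G) (Gᘁ ⊗ Xᘁ)).hom ⊗≫ Gᘁ ◁ (ε_ X Xᘁ ▷ G) ⊗≫ ε_ G Gᘁ) := by
        have : (β_ X G).hom ≫ (β_ G X).hom ≫ ((twist X).hom ⊗ₘ (twist G).hom) =
            ((twist X).hom ⊗ₘ (twist G).hom) ≫ (β_ X G).hom ≫ (β_ G X).hom := by
          simp
        rw [twist_tensor, this]
        monoidal
    _ = η_ X Xᘁ ⊗≫ (h ≫ (twist X).hom) ▷ Xᘁ ⊗≫ X ◁ trace (𝟙 G) ▷ Xᘁ ⊗≫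
          (β_ X Xᘁ).hom ≫ ε_ X Xᘁ := by
        rw [monodromy_braiding_evaluation, trace, Category.id_comp]
        calc _ = η_ X Xᘁ ⊗≫ (X ◁ (η_ G Gᘁ) ≫ (h ≫ (twist X).hom) ▷ (G ⊗ Gᘁ)) ▷ Xᘁ ⊗≫
                X ◁ (((twist G).hom ▷ Gᘁ) ≫ (β_ G Gᘁ).hom ≫ ε_ G Gᘁ) ▷ Xᘁ ⊗≫
                  (β_ X Xᘁ).hom ≫ ε_ X Xᘁ := by
                rw [MonoidalCategory.tensorHom_def]; monoidal
          _ = _ := by rw [whisker_exchange]; monoidal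
    _ = _ := by rw [hG, trace]; monoidal

theorem trace_whiskerRight_tensorPow [RightRigidCategory C] {X g : C}
    (hg : trace (𝟙 g) = 𝟙 (𝟙_ C)) (h : X ⟶ X) (n : ℕ) :
    trace (h ▷ tensorPow g n) = trace h := by
  induction n generalizing X with
  | zero =>
    have := trace_conj (ρ_ X) h
    rwa [← Category.assoc, ← rightUnitor_naturality, Category.assoc, Iso.hom_inv_id,
      Category.comp_id] at this
  | succ n ih =>
    have e : h ▷ tensorPow g (n + 1) = (α_ X (tensorPow g n) g).inv ≫
        (h ▷ tensorPow g n) ▷ g ≫ (α_ X (tensorPow g n) g).hom := by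
      simp [tensorPow]
    rw [e]
    exact (trace_conj (α_ X (tensorPow g n) g).symm _).trans ((trace_whiskerRight _ hg).trans (ih h))

end Trace

/-! ### Collecting the zesting factors of a triple product at the right. -/

section Normalization

variable {C : Type u} [Category.{v} C] [MonoidalCategory C] [BraidedCategory C]

/-- Passes the strand `L` under the strand `Z` and then fuses the strands `L` and `L'` into `G`. -/
def zNorm (A Z : C) {L L' G : C} (e : L ⊗ L' ≅ G) : ((A ⊗ L) ⊗ Z) ⊗ L' ≅ (A ⊗ Z) ⊗ G :=
  whiskerRightIso (α_ A L Z ≪≫ whiskerLeftIso A (β_ Z L).symm ≪≫ (α_ A Z L).symm) L' ≪≫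
    α_ (A ⊗ Z) L L' ≪≫ whiskerLeftIso (A ⊗ Z) e

theorem zNorm_hom (A Z : C) {L L' G : C} (e : L ⊗ L' ≅ G) :
    (zNorm A Z e).hom = 𝟙 _ ⊗≫ A ◁ (β_ Z L).inv ▷ L' ⊗≫ (A ⊗ Z) ◁ e.hom := by
  simp only [zNorm, Iso.trans_hom, whiskerRightIso_hom, whiskerLeftIso_hom, Iso.symm_hom]
  monoidal

theorem zNorm_naturality_left {A A' : C} (Z : C) {L L' G M M' G' : C} (e : L ⊗ L' ≅ G)
    (e' : M ⊗ M' ≅ G') (h : A ⟶ A') (τ : L ⟶ M) (c : L' ⟶ M') (γ : G ⟶ G')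
    (w : (τ ⊗ₘ c) ≫ e'.hom = e.hom ≫ γ) :
    (((h ⊗ₘ τ) ▷ Z) ⊗ₘ c) ≫ (zNorm A' Z e').hom = (zNorm A Z e).hom ≫ ((h ▷ Z) ⊗ₘ γ) := by
  calc (((h ⊗ₘ τ) ▷ Z) ⊗ₘ c) ≫ (zNorm A' Z e').hom =
      𝟙 _ ⊗≫ h ▷ (L ⊗ Z ⊗ L') ⊗≫ A' ◁ (τ ▷ Z) ▷ L' ⊗≫
        A' ◁ ((M ⊗ Z) ◁ c ≫ (β_ Z M).inv ▷ M') ⊗≫ (A' ⊗ Z) ◁ e'.hom := by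
        simp only [zNorm_hom, MonoidalCategory.tensorHom_def]; monoidal
    _ = 𝟙 _ ⊗≫ h ▷ (L ⊗ Z ⊗ L') ⊗≫ A' ◁ (τ ▷ Z ≫ (β_ Z M).inv) ▷ L' ⊗≫
        (A' ⊗ Z) ◁ (M ◁ c ≫ e'.hom) := by
        rw [whisker_exchange]; monoidal
    _ = 𝟙 _ ⊗≫ (h ▷ ((L ⊗ Z) ⊗ L') ≫ A' ◁ ((β_ Z L).inv ▷ L')) ⊗≫
        (A' ⊗ Z) ◁ ((τ ⊗ₘ c) ≫ e'.hom) := by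
        rw [BraidedCategory.braiding_inv_naturality_left, MonoidalCategory.tensorHom_def]; monoidal
    _ = 𝟙 _ ⊗≫ A ◁ ((β_ Z L).inv ▷ L') ⊗≫ (h ▷ (Z ⊗ L ⊗ L') ≫ A' ◁ (Z ◁ e.hom)) ⊗≫
        (A' ⊗ Z) ◁ γ := by
        rw [← whisker_exchange, w]; monoidal
    _ = _ := by
        rw [← whisker_exchange]
        simp only [zNorm_hom, MonoidalCategory.tensorHom_def]; monoidal

/-- This is the shape of a zested $\sigma_2$: associator, braiding, inverse associator. The crossing
in `zAssoc` is the one in the source `zNorm`, and the crossing in `zAssocInv` is undone by the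
target `zNorm`. What remains on the zesting factors is the composite in `w`. -/
theorem zNorm_naturality_right (X : C) {Y Z Y' Z' L L' M M' P P' Q Q' G G' : C}
    (e : L ⊗ L' ≅ G) (e' : Q ⊗ Q' ≅ G') (φ : L ⊗ L' ⟶ M ⊗ M') (h : Y ⊗ Z ⟶ Y' ⊗ Z')
    (τ : M ⟶ P) (c : M' ⟶ P') (ψ : P ⊗ P' ⟶ Q ⊗ Q') (γ : G ⟶ G')
    (w : φ ≫ (τ ⊗ₘ c) ≫ ψ ≫ e'.hom = e.hom ≫ γ) :
    (zAssoc X Y Z φ ≫ ((X ◁ (h ⊗ₘ τ)) ⊗ₘ c) ≫ zAssocInv X Y' Z' ψ) ≫ (zNorm (X ⊗ Y') Z' e').hom =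
      (zNorm (X ⊗ Y) Z e).hom ≫ (((α_ X Y Z).hom ≫ X ◁ h ≫ (α_ X Y' Z').inv) ⊗ₘ γ) := by
  calc (zAssoc X Y Z φ ≫ ((X ◁ (h ⊗ₘ τ)) ⊗ₘ c) ≫ zAssocInv X Y' Z' ψ) ≫
        (zNorm (X ⊗ Y') Z' e').hom =
      𝟙 _ ⊗≫ (X ⊗ Y) ◁ (β_ Z L).inv ▷ L' ⊗≫ X ◁ ((Y ⊗ Z) ◁ φ ≫ h ▷ (M ⊗ M')) ⊗≫
        (X ⊗ Y' ⊗ Z') ◁ ((τ ⊗ₘ c) ≫ ψ) ⊗≫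
        (X ⊗ Y') ◁ ((β_ Z' Q).hom ≫ (β_ Z' Q).inv) ▷ Q' ⊗≫ ((X ⊗ Y') ⊗ Z') ◁ e'.hom := by
        simp only [zNorm_hom, zAssoc, zAssocInv, MonoidalCategory.tensorHom_def]; monoidal
    _ = 𝟙 _ ⊗≫ (X ⊗ Y) ◁ (β_ Z L).inv ▷ L' ⊗≫ X ◁ h ▷ (L ⊗ L') ⊗≫
        (X ⊗ Y' ⊗ Z') ◁ (φ ≫ (τ ⊗ₘ c) ≫ ψ ≫ e'.hom) ⊗≫ 𝟙 _ := by
        rw [Iso.hom_inv_id, whisker_exchange]; monoidal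
    _ = 𝟙 _ ⊗≫ (X ⊗ Y) ◁ (β_ Z L).inv ▷ L' ⊗≫ X ◁ (h ▷ (L ⊗ L') ≫ (Y' ⊗ Z') ◁ e.hom) ⊗≫
        (X ⊗ Y' ⊗ Z') ◁ γ ⊗≫ 𝟙 _ := by
        rw [w]; monoidal
    _ = _ := by
        rw [← whisker_exchange]
        simp only [zNorm_hom, MonoidalCategory.tensorHom_def]; monoidal

/-- The trace of the zested category separates into the trace of `C` and a loop of `K`. -/
theorem zCoev_zEv {X X' K L L' : C} (η : 𝟙_ C ⟶ X ⊗ X') (ε : X' ⊗ X ⟶ 𝟙_ C)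
    (κ : 𝟙_ C ⟶ K ⊗ L) (μ : K ⊗ L' ⟶ 𝟙_ C) (f : X ⟶ X) (τ : L ⟶ L') :
    zCoev η κ ≫ ((f ▷ (X' ⊗ K)) ⊗ₘ 𝟙 L) ≫ ((β_ X (X' ⊗ K)).hom ⊗ₘ τ) ≫ zEv ε μ =
      (η ≫ f ▷ X' ≫ (β_ X X').hom ≫ ε) ≫ κ ≫ K ◁ τ ≫ μ := by
  calc _ = η ⊗≫ ((X ⊗ X') ◁ κ ≫ (f ▷ X') ▷ (K ⊗ L)) ⊗≫ ((β_ X X').hom ▷ (K ⊗ L)) ⊗≫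
        X' ◁ ((β_ X K).hom ▷ L ≫ (K ⊗ X) ◁ τ) ⊗≫ X' ◁ (β_ X K).inv ▷ L' ⊗≫ ε ▷ (K ⊗ L') ⊗≫ μ := by
        simp only [zCoev, zEv, MonoidalCategory.tensorHom_def,
          BraidedCategory.braiding_tensor_right_hom]
        monoidal
    -- The crossing of `X` with `K` in the braiding past `X' ⊗ K` meets its inverse in `zEv`, so the
    -- loop of `K` is not linked with `X`.
    _ = η ⊗≫ f ▷ X' ⊗≫ ((X ⊗ X') ◁ κ ≫ (β_ X X').hom ▷ (K ⊗ L)) ⊗≫ (X' ⊗ X) ◁ (K ◁ τ) ⊗≫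
        X' ◁ ((β_ X K).hom ≫ (β_ X K).inv) ▷ L' ⊗≫ ε ▷ (K ⊗ L') ⊗≫ μ := by
        rw [whisker_exchange, ← whisker_exchange (β_ X K).hom]; monoidal
    _ = η ⊗≫ f ▷ X' ⊗≫ (β_ X X').hom ⊗≫ ((X' ⊗ X) ◁ (κ ≫ K ◁ τ) ≫ ε ▷ (K ⊗ L')) ⊗≫ μ := by
        rw [Iso.hom_inv_id, whisker_exchange]; monoidal
    _ = _ := by
        rw [whisker_exchange]; monoidal

end Normalization

/-! ### Canonical isomorphisms between powers of $g$, and the loop of the zested dual. -/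

section Powers

variable {C : Type u} [Category.{v} C] [MonoidalCategory C]

theorem tensorPowAdd_eqToHom (g : C) {m n m' n' : ℕ} (hm : m = m') (hn : n = n') :
    (eqToHom (congrArg (tensorPow g) hm) ⊗ₘ eqToHom (congrArg (tensorPow g) hn)) ≫
        (tensorPowAdd g m' n').hom =
      (tensorPowAdd g m n).hom ≫ eqToHom (by rw [hm, hn]) := by
  subst hm hn
  simp

theorem tensorPowIso_hom_tensor_eqToHom (g : C) {m n m' n' : ℕ} (h : m + n = m' + n') (hn : n = 0)
    (hn' : n' = 0) :
    (tensorPowIso g h).hom ≫ _ ◁ eqToHom (show tensorPow g n' = 𝟙_ C by rw [hn', tensorPow]) =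
      _ ◁ eqToHom (show tensorPow g n = 𝟙_ C by rw [hn, tensorPow]) ≫ 
        eqToHom (show tensorPow g m = tensorPow g m' by
          rw [hn, hn', add_zero, add_zero] at h; rw [h]) ▷ 𝟙_ C := by
  subst hn hn'
  obtain rfl : m = m' := h
  -- By definition `tensorPowAdd g m 0` is the right unitor, so the canonical isomorphism is
  -- trivial.
  change ((ρ_ _).hom ≫ 𝟙 _ ≫ (ρ_ _).inv) ≫ _ ◁ 𝟙 _ = _ ◁ 𝟙 _ ≫ 𝟙 _ ▷ _
  simp

variable {k : Type w} [Field k] [Abelian C] [Linear k C] [MonoidalPreadditive C] [MonoidalLinear k C]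

/-- This supplies the hypothesis `w` of `zNorm_naturality_right` for $\sigma_2$. The canonical
isomorphisms all factor through a single power of `g` and cancel there, so only the scalars survive:
`a` and `c` from the two associators, `b` from $t$. -/
theorem tensorPowIso_comp_inv (g : C) {m n m₁ n₁ m₂ n₂ m₃ n₃ : ℕ} (h₁ : m + n = m₁ + n₁)
    (hm : m₁ = m₂) (hn : n₁ = n₂) (h₂ : m₃ + n₃ = m₂ + n₂) (a b c : k) :
    (a • (tensorPowIso g h₁).hom) ≫ ((b • eqToHom (congrArg (tensorPow g) hm)) ⊗ₘ
        eqToHom (congrArg (tensorPow g) hn)) ≫ (c • (tensorPowIso g h₂).inv) ≫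
          (tensorPowAdd g m₃ n₃).hom =
      (tensorPowAdd g m n).hom ≫
        ((a * c * b) • eqToHom (congrArg (tensorPow g) (show m + n = m₃ + n₃ by omega))) := by
  subst hm hn
  simp only [tensorPowIso, MonoidalCategory.tensorHom_def, eqToHom_refl, Iso.trans_hom,
    Iso.trans_inv, Iso.symm_hom, Iso.symm_inv, eqToIso.hom, eqToIso.inv, Linear.smul_comp,
    Linear.comp_smul, smul_smul, MonoidalLinear.smul_whiskerRight, whiskerLeft_id,
    id_whiskerRight, Category.assoc, Iso.inv_hom_id_assoc, Category.id_comp, Iso.inv_hom_id,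
    Category.comp_id, eqToHom_trans]
  congr 1
  ring

theorem smul_tensorHom {X X' Y Y' : C} (u : k) (f : X ⟶ X') (g : Y ⟶ Y') :
    (u • f) ⊗ₘ g = u • (f ⊗ₘ g) := by
  simp [MonoidalCategory.tensorHom_def, MonoidalLinear.smul_whiskerRight]

theorem tensorHom_smul {X X' Y Y' : C} (u : k) (f : X ⟶ X') (g : Y ⟶ Y') :
    f ⊗ₘ (u • g) = u • (f ⊗ₘ g) := by
  simp [MonoidalCategory.tensorHom_def, MonoidalLinear.whiskerLeft_smul]

/-- The isomorphism `zMu` is built from the inverses of `κ` and `φ`. When `φ` is `c` times `τ`, up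
to the unit identifications `p` and `r`, the loop closed by `κ` and `zMu` is therefore $c^{-1}$. -/
theorem zMu_loop {K L L' P R : C} (κ : 𝟙_ C ≅ K ⊗ L) (φ : L ⊗ P ≅ L' ⊗ R) (p : P ≅ 𝟙_ C)
    (r : R ≅ 𝟙_ C) (τ : L ≅ L') (c : k) (h : φ.hom ≫ L' ◁ r.hom = c • (L ◁ p.hom ≫ τ.hom ▷ 𝟙_ C)) :
    c • (κ.hom ≫ K ◁ τ.hom ≫ (zMu κ φ p r).hom) = 𝟙 _ := by
  -- The hypothesis is solved for `φ.inv`, the form in which `φ` enters `zMu`.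
  have e : c • (τ.hom ▷ 𝟙_ C ≫ L' ◁ r.inv ≫ φ.inv) = L ◁ p.inv := by
    have e' : φ.hom = c • (L ◁ p.hom ≫ τ.hom ▷ 𝟙_ C ≫ L' ◁ r.inv) := by
      rw [← Category.assoc, ← Linear.smul_comp, ← h]
      simp
    rw [← cancel_epi (L ◁ p.hom), ← whiskerLeft_comp, Iso.hom_inv_id, whiskerLeft_id,
      ← φ.hom_inv_id]
    conv_rhs => rw [e']
    simp
  calc c • (κ.hom ≫ K ◁ τ.hom ≫ (zMu κ φ p r).hom) =
      κ.hom ≫ (ρ_ _).inv ≫ (α_ _ _ _).hom ≫ K ◁ (c • (τ.hom ▷ 𝟙_ C ≫ L' ◁ r.inv ≫ φ.inv)) ≫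
        (α_ _ _ _).inv ≫ κ.inv ▷ P ≫ (λ_ P).hom ≫ p.hom := by
        simp only [zMu, MonoidalLinear.whiskerLeft_smul, Linear.comp_smul, Linear.smul_comp]
        simp
    _ = 𝟙 _ ⊗≫ κ.hom ⊗≫ ((K ⊗ L) ◁ p.inv ≫ κ.inv ▷ P) ⊗≫ p.hom := by
        rw [e]; monoidal
    _ = 𝟙 _ ⊗≫ (κ.hom ≫ κ.inv) ⊗≫ (p.inv ≫ p.hom) ⊗≫ 𝟙 _ := by
        rw [whisker_exchange]; monoidal
    _ = _ := by
        rw [Iso.hom_inv_id, Iso.inv_hom_id]; monoidal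

end Powers

/-! ### The zested trace and the zested braid generators for a cyclic zesting. -/

section Cyclic

variable {k : Type w} [Field k] {C : Type u} [Category.{v} C] [Abelian C] [Linear k C]
  [MonoidalCategory C] [MonoidalPreadditive C] [MonoidalLinear k C] [BraidedCategory C]
  [BalancedCategory C] [RightRigidCategory C] {N : ℕ} [NeZero N] {𝒢 : Grading C (ZMod N)}

/-- The scalars of `f`, `t` and `λ_b` that occur in the zested trace cancel. -/
theorem CyclicZestingData.trace_scalar (D : CyclicZestingData k 𝒢) (i : ZMod N) :
    D.s⁻¹ ^ (i.val ^ 2) * D.s⁻¹ ^ (i.val * (-i).val) = D.scalar i (-i) i := by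
  by_cases hi : i = 0
  · subst hi
    simp [scalar, NeZero.pos]
  -- For $i\ne0$ the representatives of $i$ and $-i$ add up to exactly $N$: there is a carry, and
  -- $i^2+i(N-i)=iN$. For $i=0$ there is no carry and both sides are $1$.
  · have hv : (-i).val + i.val = N := by
      have := ZMod.val_lt i
      have : NeZero i := ⟨hi⟩
      rw [ZMod.val_neg_of_ne_zero]; omega
    have hs : D.ζ ^ (epsilon D.g D.a + 2 * D.b.val) = D.s⁻¹ ^ N := by
      rw [inv_pow, D.s_pow, inv_inv]
    rw [scalar, if_neg (by omega), pow_mul' D.ζ, hs, ← pow_mul, ← pow_add]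
    congr 1
    linear_combination i.val * hv

namespace CyclicRibbonZesting

/-- By `zCoev_zEv` the zested trace is a trace in $\mathcal C$ times a loop. The loop contributes
$\lambda_b(i,-i,i)^{-1}$, the twist $f_s(i)$ and the braiding $t_s(i,-i)$; `trace_scalar` says that
these cancel. -/
theorem zested_trace_hom (D : CyclicRibbonZesting k 𝒢) {W : Zested D.ribbonZesting} (F : W ⟶ W) :
    (trace F).hom = trace F.hom := by
  obtain ⟨i, W, hW⟩ := W
  let Z := D.zestingData
  have h : (trace F).hom = zCoev (η_ W Wᘁ) (Zested.lamInvIso Z i).hom ≫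
      (((F.hom ≫ ((Z.f i : k) • (twist W).hom)) ▷ (Wᘁ ⊗ Zested.lamInv Z i)) ⊗ₘ 𝟙 _) ≫
      ((β_ W (Wᘁ ⊗ Zested.lamInv Z i)).hom ⊗ₘ (Z.t i (-i)).hom) ≫
      zEv (ε_ W Wᘁ) (Zested.dualMu Z i).hom := rfl
  rw [h, zCoev_zEv]
  have hl := zMu_loop (Zested.lamInvIso Z i) (Z.assoc i (-i) i)
    (eqToIso (by rw [add_neg_cancel]) ≪≫ Z.lamLeft i)
    (eqToIso (by rw [neg_add_cancel]) ≪≫ Z.lamRight i)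
    (eqToIso (by simp only [Z, CyclicZestingData.zestingData]; rw [zestingExponent_comm]))
    -- The associator is this scalar times a canonical isomorphism, which reduces to an
    -- identification of objects because $\lambda(0,i)$ and $\lambda(i,0)$ are the zeroth power of
    -- $g$.
    (D.scalar i (-i) i : k) (by
      have e := tensorPowIso_hom_tensor_eqToHom D.g (zestingExponent_assoc D.a i (-i) i)
        (by rw [add_neg_cancel, zestingExponent_zero_left])
        (by rw [neg_add_cancel, zestingExponent_zero_right])
      have hp := eqToHom_trans (show Z.lam (i + -i) i = Z.lam 0 i by rw [add_neg_cancel])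
        (show tensorPow D.g (zestingExponent D.a 0 i) = 𝟙_ C by
          rw [zestingExponent_zero_left, tensorPow])
      have hr := eqToHom_trans (show Z.lam i (-i + i) = Z.lam i 0 by rw [neg_add_cancel])
        (show tensorPow D.g (zestingExponent D.a i 0) = 𝟙_ C by
          rw [zestingExponent_zero_right, tensorPow])
      refine (congrArg (_ ≫ _ ◁ ·) hr).trans (((Linear.smul_comp _ _ _ _ _ _).trans ?_).trans
        (congrArg (fun x => _ • (_ ◁ x ≫ _)) hp.symm))
      exact congrArg (_ • ·) e)
  rw [← CyclicZestingData.trace_scalar] at hl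
  have ht : (Z.t i (-i)).hom = ((D.s⁻¹ ^ (i.val * (-i).val) : kˣ) : k) •
    eqToHom (by simp only [Z, CyclicZestingData.zestingData]; rw [zestingExponent_comm]) := rfl
  have hf : Z.f i = D.s⁻¹ ^ (i.val ^ 2) := rfl
  rw [ht, hf]
  simp only [Linear.comp_smul, MonoidalLinear.smul_whiskerRight, Linear.smul_comp,
    MonoidalLinear.whiskerLeft_smul, smul_smul]
  rw [mul_comm, ← Units.val_mul, ← Linear.comp_smul]
  exact (congrArg (_ ≫ ·) hl).trans (Category.comp_id _)

/-- The isomorphism that collects the powers of `g` in a zested triple tensor product at the right. -/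
def norm (D : CyclicRibbonZesting k 𝒢) (X Y V : Zested D.ribbonZesting) :
    ((X ⊗ Y) ⊗ V).obj ≅ ((X.obj ⊗ Y.obj) ⊗ V.obj) ⊗
      tensorPow D.g (zestingExponent D.a X.deg Y.deg + zestingExponent D.a (X.deg + Y.deg) V.deg) :=
  zNorm (X.obj ⊗ Y.obj) V.obj (tensorPowAdd D.g _ _)

/-- After normalization, the morphism `F` of the zested category is the morphism `u • h` of `C`,
tensored with the identity of a power of `g`. -/
def Normalizes (D : CyclicRibbonZesting k 𝒢) {X Y V X' Y' V' : Zested D.ribbonZesting}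
    (F : (X ⊗ Y) ⊗ V ⟶ (X' ⊗ Y') ⊗ V')
    (h : (X.obj ⊗ Y.obj) ⊗ V.obj ⟶ (X'.obj ⊗ Y'.obj) ⊗ V'.obj) (u : kˣ) : Prop :=
  ∃ e : zestingExponent D.a X.deg Y.deg + zestingExponent D.a (X.deg + Y.deg) V.deg =
      zestingExponent D.a X'.deg Y'.deg + zestingExponent D.a (X'.deg + Y'.deg) V'.deg,
    F.hom ≫ (D.norm X' Y' V').hom =
      (u : k) • ((D.norm X Y V).hom ≫ (h ⊗ₘ eqToHom (congrArg (tensorPow D.g) e)))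

variable {D : CyclicRibbonZesting k 𝒢}

theorem Normalizes.comp {X Y V X' Y' V' X'' Y'' V'' : Zested D.ribbonZesting}
    {F : (X ⊗ Y) ⊗ V ⟶ (X' ⊗ Y') ⊗ V'} {h : (X.obj ⊗ Y.obj) ⊗ V.obj ⟶ (X'.obj ⊗ Y'.obj) ⊗ V'.obj}
    {u : kˣ} (hF : D.Normalizes F h u) {F' : (X' ⊗ Y') ⊗ V' ⟶ (X'' ⊗ Y'') ⊗ V''}
    {h' : (X'.obj ⊗ Y'.obj) ⊗ V'.obj ⟶ (X''.obj ⊗ Y''.obj) ⊗ V''.obj}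
    {u' : kˣ} (hF' : D.Normalizes F' h' u') : D.Normalizes (F ≫ F') (h ≫ h') (u * u') := by
  obtain ⟨e, hF⟩ := hF
  obtain ⟨e', hF'⟩ := hF'
  refine ⟨e.trans e', ?_⟩
  rw [Zested.comp_hom, Category.assoc, hF', Linear.comp_smul, reassoc_of% hF, Linear.smul_comp,
    smul_smul, Category.assoc, tensorHom_comp_tensorHom, eqToHom_trans, mul_comm, Units.val_mul]

theorem Normalizes.inv {X Y V X' Y' V' : Zested D.ribbonZesting}
    {F : (X ⊗ Y) ⊗ V ≅ (X' ⊗ Y') ⊗ V'} {h : (X.obj ⊗ Y.obj) ⊗ V.obj ≅ (X'.obj ⊗ Y'.obj) ⊗ V'.obj}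
    {u : kˣ} (hF : D.Normalizes F.hom h.hom u) : D.Normalizes F.inv h.inv u⁻¹ := by
  obtain ⟨e, hF⟩ := hF
  refine ⟨e.symm, ?_⟩
  have hi : F.inv.hom ≫ F.hom.hom = 𝟙 _ := by rw [← Zested.comp_hom, F.inv_hom_id]; rfl
  -- Solving the relation for the source normalization puts `F.hom` in front, where `F.inv` cancels
  -- it.
  have hF' : (D.norm X Y V).hom = (u : k)⁻¹ • (F.hom.hom ≫ (D.norm X' Y' V').hom ≫
      (h.inv ⊗ₘ eqToHom (congrArg (tensorPow D.g) e.symm))) := by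
    rw [reassoc_of% hF, Linear.smul_comp, smul_smul, inv_mul_cancel₀ u.ne_zero, one_smul,
      Category.assoc, tensorHom_comp_tensorHom]
    simp
  rw [hF', Linear.comp_smul, reassoc_of% hi, Units.val_inv_eq_inv_val]

/-- For an endomorphism, source and target have the same normalization, so the underlying morphism
is conjugate to `u • h` tensored with the identity of a power of $g$, and that power has no effect
on the trace. -/
theorem Normalizes.trace {X Y V : Zested D.ribbonZesting}
    {F : (X ⊗ Y) ⊗ V ⟶ (X ⊗ Y) ⊗ V} {h : (X.obj ⊗ Y.obj) ⊗ V.obj ⟶ (X.obj ⊗ Y.obj) ⊗ V.obj}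
    {u : kˣ} (hF : D.Normalizes F h u) :
    (ZestedLinks.trace F).hom = (u : k) • ZestedLinks.trace h := by
  obtain ⟨e, hF⟩ := hF
  rw [eqToHom_refl, tensorHom_id] at hF
  have hF' : F.hom = (D.norm X Y V).hom ≫ ((u : k) • (h ▷ _)) ≫ (D.norm X Y V).inv := by
    rw [Linear.smul_comp, Linear.comp_smul, ← Category.assoc, ← Linear.smul_comp, ← hF]
    simp
  rw [zested_trace_hom, hF', trace_conj, ← MonoidalLinear.smul_whiskerRight,
    trace_whiskerRight_tensorPow D.g_dim]
  simp [ZestedLinks.trace, MonoidalLinear.smul_whiskerRight]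

/-- Morphisms on the first two strands involve no associator, hence no factor $\lambda_b$. This
covers $\sigma_1$ and the inserted twist. -/
theorem normalizes_whiskerRight {X Y X' Y' : Zested D.ribbonZesting} (V : Zested D.ribbonZesting)
    (F : X ⊗ Y ⟶ X' ⊗ Y') (h : X.obj ⊗ Y.obj ⟶ X'.obj ⊗ Y'.obj) (u : kˣ)
    (e : zestingExponent D.a X.deg Y.deg = zestingExponent D.a X'.deg Y'.deg)
    (hF : F.hom = (u : k) • (h ⊗ₘ eqToHom (congrArg (tensorPow D.g) e))) :
    D.Normalizes (F ▷ V) (h ▷ V.obj) u := by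
  have e' : X.deg + Y.deg = X'.deg + Y'.deg := F.deg_eq
  refine ⟨by rw [e, e'], ?_⟩
  have := zNorm_naturality_left V.obj (tensorPowAdd D.g _ _) (tensorPowAdd D.g _ _) h _ _ _
    (tensorPowAdd_eqToHom D.g e (congrArg (fun x => zestingExponent D.a x V.deg) e'))
  have hs {A A' B G G' : C} (f : A ⟶ A') (g : G ⟶ G') :
      ((u : k) • f) ▷ B ⊗ₘ g = (u : k) • (f ▷ B ⊗ₘ g) := by
    rw [MonoidalLinear.smul_whiskerRight, smul_tensorHom]
  rw [Zested.whiskerRight_hom, hF]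
  refine (congrArg (· ≫ _) (hs _ _)).trans ((Linear.smul_comp _ _ _ _ _ _).trans ?_)
  exact congrArg ((u : k) • ·) this

theorem normalizes_sigma₁ (X Y V : Zested D.ribbonZesting) :
    D.Normalizes (sigma₁ X Y V).hom (sigma₁ X.obj Y.obj V.obj).hom
      (D.s⁻¹ ^ (X.deg.val * Y.deg.val)) := by
  refine normalizes_whiskerRight V (β_ X Y).hom (β_ X.obj Y.obj).hom _
    (zestingExponent_comm _ _ _) ?_
  exact tensorHom_smul _ _ _

theorem normalizes_sigma₂ (X Y V : Zested D.ribbonZesting) :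
    D.Normalizes (sigma₂ X Y V).hom (sigma₂ X.obj Y.obj V.obj).hom
      (D.scalar X.deg Y.deg V.deg * (D.scalar X.deg V.deg Y.deg)⁻¹ *
        D.s⁻¹ ^ (Y.deg.val * V.deg.val)) := by
  -- Both exponents are $a$ times the number of carries in the sum of the three degrees, which does
  -- not depend on their order.
  refine ⟨by rw [zestingExponent_assoc, zestingExponent_comm D.a Y.deg, add_comm Y.deg,
    ← zestingExponent_assoc], ?_⟩
  have := zNorm_naturality_right X.obj (tensorPowAdd D.g _ _) (tensorPowAdd D.g _ _) _
    (β_ Y.obj V.obj).hom _ _ _ _ (tensorPowIso_comp_inv D.g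
      (zestingExponent_assoc D.a X.deg Y.deg V.deg) (zestingExponent_comm D.a Y.deg V.deg)
      (congrArg (zestingExponent D.a X.deg) (add_comm Y.deg V.deg))
      (zestingExponent_assoc D.a X.deg V.deg Y.deg) (D.scalar X.deg Y.deg V.deg : k)
      ((D.s⁻¹ ^ (Y.deg.val * V.deg.val) : kˣ) : k)
      (((D.scalar X.deg V.deg Y.deg)⁻¹ : kˣ) : k))
  rw [← Units.val_mul, ← Units.val_mul] at this
  exact this.trans ((congrArg (_ ≫ ·) (tensorHom_smul _ _ _)).trans (Linear.comp_smul _ _ _ _ _ _))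

theorem normalizes_twist (X Y V : Zested D.ribbonZesting) :
    D.Normalizes ((X ◁ (twist Y).inv) ▷ V) ((X.obj ◁ (twist Y.obj).inv) ▷ V.obj)
      (D.s ^ (Y.deg.val ^ 2)) := by
  refine normalizes_whiskerRight V _ _ _ rfl ?_
  change (X.obj ◁ ((((D.s⁻¹ ^ (Y.deg.val ^ 2))⁻¹ : kˣ) : k) • (twist Y.obj).inv)) ⊗ₘ 𝟙 _ = _
  -- The zested twist carries $s^{-j^2}$, so its inverse contributes $s^{j^2}$.
  rw [inv_pow, inv_inv, MonoidalLinear.whiskerLeft_smul]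
  exact smul_tensorHom _ _ _

end CyclicRibbonZesting

end Cyclic

/-! ### Scalar count for the Whitehead link, the Borromean rings and $5_2$. -/

section Cyclic

variable {k : Type w} [Field k] {C : Type u} [Category.{v} C] [Abelian C] [Linear k C]
  [MonoidalCategory C] [MonoidalPreadditive C] [MonoidalLinear k C] [BraidedCategory C]
  [BalancedCategory C] [RightRigidCategory C] {N : ℕ} [NeZero N] {𝒢 : Grading C (ZMod N)}

/-- Each carry occurs twice in the Borromean braid, with opposite signs. -/
theorem CyclicZestingData.scalar_cyclic (D : CyclicZestingData k 𝒢) (i j l : ZMod N) :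
    D.scalar i j l * D.scalar l i j * D.scalar j l i =
      D.scalar i l j * D.scalar l j i * D.scalar j i l := by
  -- The scalar $\lambda_b(i,j,l)$ depends on $i$ and $j$ only through the carry of $i+j$, which is
  -- symmetric.
  simp only [scalar, add_comm l.val i.val, add_comm l.val j.val, add_comm j.val i.val]
  split_ifs <;> simp [mul_comm, mul_assoc]

namespace CyclicRibbonZesting

variable {D : CyclicRibbonZesting k 𝒢}

theorem whiteheadInvariant_hom (X Y : Zested D.ribbonZesting) :
    (whiteheadInvariant X Y).hom =
      (D.s : k) ^ (X.deg.val ^ 2 + Y.deg.val ^ 2) • whiteheadInvariant X.obj Y.obj := by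
  have h := ((normalizes_twist X Y X).comp ((normalizes_sigma₂ X Y X).comp
    ((normalizes_sigma₁ X X Y).inv.comp ((normalizes_sigma₂ X X Y).comp
      ((normalizes_sigma₁ Y X X).inv.comp (normalizes_sigma₁ X Y X).inv))))).trace
  refine h.trans ?_
  rw [← Units.val_pow_eq_pow_val]
  congr 2
  simp only [inv_pow, inv_inv, mul_comm Y.deg.val X.deg.val, pow_add, ← sq X.deg.val]
  -- Here $a=\lambda_b(i,j,i)$, $b=\lambda_b(i,i,j)$, $p=s^{ij}$, $x=s^{i^2}$ and $y=s^{j^2}$. The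
  -- two occurrences of $\sigma_2$ have opposite associator factors, and the four mixed crossings
  -- cancel.
  have key (a b p x y : kˣ) :
      y * (a * b⁻¹ * p⁻¹ * (x * (b * a⁻¹ * p⁻¹ * (p * p)))) = x * y := by
    ext; push_cast; field_simp
  exact key _ _ _ _ _

theorem borromeanInvariant_hom (X Y V : Zested D.ribbonZesting) :
    (borromeanInvariant X Y V).hom = borromeanInvariant X.obj Y.obj V.obj := by
  have h := ((normalizes_sigma₂ X Y V).comp ((normalizes_sigma₁ V X Y).inv.comp
    ((normalizes_sigma₂ V X Y).comp ((normalizes_sigma₁ Y V X).inv.comp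
      ((normalizes_sigma₂ Y V X).comp (normalizes_sigma₁ X Y V).inv))))).trace
  refine h.trans ((congrArg (fun u : kˣ => (u : k) • borromeanInvariant X.obj Y.obj V.obj)
    (?_ : _ = (1 : kˣ))).trans (one_smul k _))
  have e := D.scalar_cyclic X.deg Y.deg V.deg
  simp only [mul_comm V.deg.val]
  rw [← mul_inv_eq_one] at e
  rw [← e]
  simp only [mul_inv]
  -- Here $p=s^{-ij}$, $q=s^{-il}$ and $r=s^{-jl}$: each pair of components crosses once with each
  -- sign. The letters $a,b,c$ and $a',b',c'$ stand for the associator factors and inverse factors,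
  -- whose product is $1$ by `scalar_cyclic`.
  have key (a b c a' b' c' p q r : kˣ) : a * a' * r * (q⁻¹ * (b * b' * p * (r⁻¹ *
      (c * c' * q * p⁻¹)))) = a * b * c * (a' * b' * c') := by
    ext; push_cast; field_simp
  exact key _ _ _ _ _ _ _ _ _

theorem fiveTwoInvariant_hom (X : Zested D.ribbonZesting) :
    (fiveTwoInvariant X).hom = (D.s : k) ^ (4 * X.deg.val ^ 2) • fiveTwoInvariant X.obj := by
  have h := ((normalizes_sigma₂ X X X).inv.comp ((normalizes_sigma₁ X X X).comp
    ((normalizes_sigma₂ X X X).inv.comp ((normalizes_sigma₁ X X X).inv.comp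
      ((normalizes_sigma₁ X X X).inv.comp (normalizes_sigma₁ X X X).inv))))).trace
  refine h.trans ?_
  rw [← Units.val_pow_eq_pow_val]
  congr 2
  -- With equal colours the two associator factors of each $\sigma_2$ are inverse to each other, so
  -- only the five negative crossings and the one positive crossing count.
  simp only [mul_inv_cancel, one_mul, inv_pow, inv_inv, ← sq X.deg.val, inv_mul_cancel_left]
  rw [mul_comm 4, pow_mul]
  ext; push_cast; ring

end CyclicRibbonZesting

end Cyclic

end

end ZestedLinks

open ZestedLinks in
theorem proposition5p3 {k : Type w} [Field k] [IsAlgClosed k] [CharZero k]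
    {C : Type u} [Category.{v} C] [Abelian C] [Linear k C] [MonoidalCategory C]
    [MonoidalPreadditive C] [MonoidalLinear k C] [BraidedCategory C] [RigidCategory C]
    [RibbonCategory C] [IsModularCategory k C]
    {N : ℕ} [NeZero N] (𝒢 : Grading C (ZMod N)) (D : CyclicRibbonZesting k 𝒢)
    (i j l : ZMod N) (X Y V : C) (hX : 𝒢.comp i X) (hY : 𝒢.comp j Y) (hV : 𝒢.comp l V) :
    (whiteheadInvariant (D.zest hX) (D.zest hY)).hom =
        (D.s : k) ^ (i.val ^ 2 + j.val ^ 2) • whiteheadInvariant X Y ∧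
      (borromeanInvariant (D.zest hX) (D.zest hY) (D.zest hV)).hom = borromeanInvariant X Y V ∧
      (fiveTwoInvariant (D.zest hX)).hom = (D.s : k) ^ (4 * i.val ^ 2) • fiveTwoInvariant X :=
  ⟨CyclicRibbonZesting.whiteheadInvariant_hom (D.zest hX) (D.zest hY),
    CyclicRibbonZesting.borromeanInvariant_hom (D.zest hX) (D.zest hY) (D.zest hV),
    CyclicRibbonZesting.fiveTwoInvariant_hom (D.zest hX)⟩
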